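/- Let $(\overline M,\sigma,\overline g)$ be a quaternionic space form $\overline M^{4m}(c)$: a smooth Riemannian manifold of dimension $4m$ with a rank-3 subbundle $\sigma\subset\mathrm{End}(T\overline M)$ that has, around every point, a canonical local basis $\{J_1,J_2,J_3\}$ (that is, $J_\alpha^2=-\mathrm{Id}$ and $J_\alpha J_{\alpha+1}=-J_{\alpha+1}J_\alpha=J_{\alpha+2}$, indices modulo 3), such that $\overline g(J_\alpha X,J_\alpha Y)=\overline g(X,Y)$ for every canonical local basis, $\sigma$ is parallel for the Levi-Civita connection, and every plane contained in a space $Q(X)=\mathrm{span}\{X,J_1X,J_2X,J_3X\}$, $X\neq 0$, has sectional curvature $c$. Let $M$ be an $n$-dimensional proper slant submanifold of $\overline M$ with slant angle $\theta$, with the induced metric. Slant means that at every $p\in M$, for a canonical local basis of $\sigma$ around $p$, every $\alpha\in\{1,2,3\}$ and every nonzero $X\in T_pM$, the angle between $J_\alpha X$ and $T_pM$ equals the constant $\theta$. Proper means that $M$ is neither quaternionic ($J(T_pM)\subset T_pM$ for all $p\in M$, $J\in\sigma_p$) nor totally real ($J(T_pM)\subset T_pM^{\perp}$ for all $p\in M$,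 $J\in\sigma_p$). Then for every $p\in M$ and every integer $k$ with $2\le k\le n$, $$\|H\|^2(p)\;\ge\;\Theta_k(p)-\frac c4\left(1+\frac{9}{n-1}\cos^2\theta\right).$$ Here $H(p)=\frac1n\sum_{i=1}^n h(e_i,e_i)$ is the mean curvature vector, where $h$ is the second fundamental form of $M$ and $\{e_i\}$ is an orthonormal basis of $T_pM$, and $$\Theta_k(p)=\frac1{k-1}\inf_{L,X}\mathrm{Ric}_L(X),$$ where $L$ runs over the $k$-dimensional subspaces of $T_pM$, $X$ over the unit vectors in $L$, and $\mathrm{Ric}_L(X)=\sum_{j=2}^k K(X\wedge e_j)$ for an orthonormal basis $\{X,e_2,\dots,e_k\}$ of $L$, $K$ being the sectional curvature of $M$. -/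

import Mathlib

open Bundle Manifold
open scoped ContDiff Topology

noncomputable section

namespace QuaternionicSlant

notation "𝔼" d:max => EuclideanSpace ℝ (Fin d)

instance instFiniteDimensionalTangentSpace {d : ℕ} {N : Type*} [TopologicalSpace N]
    [ChartedSpace (𝔼 d) N] (p : N) : FiniteDimensional ℝ (TangentSpace 𝓘(ℝ, 𝔼 d) p) :=
  inferInstanceAs (FiniteDimensional ℝ (𝔼 d))

/-! ### Levi-Civita connection and curvature of a Riemannian metric on a vector space

Here `B` is a field of bilinear forms on `E` (a Riemannian metric in local coordinates). -/

section Coordinates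

variable {E : Type*} [NormedAddCommGroup E] [NormedSpace ℝ E]

/-- The covector `w ↦ ½ (∂_u B(v, w) + ∂_v B(u, w) - ∂_w B(u, v))` at `x`, i.e. `B(∇_u v, w)` for
constant vector fields `u`, `v`, `w` (Koszul formula). -/
def koszul (B : E → E →L[ℝ] E →L[ℝ] ℝ) (x u v : E) : E →L[ℝ] ℝ :=
  (1 / 2 : ℝ) • (fderiv ℝ B x u v + fderiv ℝ B x v u - ((fderiv ℝ B x).flip u).flip v)

/-- The Christoffel symbol `Γ_x(u, v) = ∇_u v` (for constant vector fields `u`, `v`) of the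
Levi-Civita connection of `B`: the vector with `B_x(Γ_x(u, v), ·) = koszul B x u v`. -/
def christoffel (B : E → E →L[ℝ] E →L[ℝ] ℝ) (x u v : E) : E :=
  ContinuousLinearMap.inverse (B x) (koszul B x u v)

/-- The curvature `R(u, v)w = ∇_u ∇_v w - ∇_v ∇_u w - ∇_[u, v] w` of the Levi-Civita connection of
`B` at `x`, computed with constant vector fields. -/
def coordCurvature (B : E → E →L[ℝ] E →L[ℝ] ℝ) (x u v w : E) : E :=
  fderiv ℝ (fun y => christoffel B y v w) x u - fderiv ℝ (fun y => christoffel B y u w) x v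
    + christoffel B x u (christoffel B x v w) - christoffel B x v (christoffel B x u w)

/-- The covariant derivative `(∇_u A)v = ∇_u (A v) - A (∇_u v)` of a field `A` of endomorphisms,
at `x`. -/
def coordCovDerivEnd (B : E → E →L[ℝ] E →L[ℝ] ℝ) (A : E → E →L[ℝ] E) (x u v : E) : E :=
  fderiv ℝ A x u v + christoffel B x u (A x v) - A x (christoffel B x u v)

end Coordinates

/-! ### Riemannian manifolds

A Riemannian manifold of dimension `d` is a manifold modelled on `𝔼 d` whose tangent bundle is a
(smooth) Riemannian bundle. In Mathlib, `TangentSpace 𝓘(ℝ, 𝔼 d) p` is `𝔼 d`, a tangent vector at `p`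
being identified with its coordinates in the preferred chart `extChartAt 𝓘(ℝ, 𝔼 d) p`; so a
tensor at `p` is the value, at the point `extChartAt 𝓘(ℝ, 𝔼 d) p p`, of its expression in that
chart. -/

section Riemannian

variable {d : ℕ} {N : Type*} [TopologicalSpace N] [ChartedSpace (𝔼 d) N]

/-- The coordinate basis map at the point with coordinates `x` in the preferred chart at `p`: the
derivative of the inverse chart. -/
def coordFrame (p : N) (x : 𝔼 d) :
    𝔼 d →L[ℝ] TangentSpace 𝓘(ℝ, 𝔼 d) ((extChartAt 𝓘(ℝ, 𝔼 d) p).symm x) :=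
  mfderiv 𝓘(ℝ, 𝔼 d) 𝓘(ℝ, 𝔼 d) (extChartAt 𝓘(ℝ, 𝔼 d) p).symm x

/-- The expression, in the preferred chart at `p`, of a field `A` of endomorphisms of the tangent
spaces. -/
def coordEnd (A : ∀ y : N, TangentSpace 𝓘(ℝ, 𝔼 d) y →L[ℝ] TangentSpace 𝓘(ℝ, 𝔼 d) y)
    (p : N) (x : 𝔼 d) : 𝔼 d →L[ℝ] 𝔼 d :=
  (mfderiv 𝓘(ℝ, 𝔼 d) 𝓘(ℝ, 𝔼 d) (extChartAt 𝓘(ℝ, 𝔼 d) p)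
      ((extChartAt 𝓘(ℝ, 𝔼 d) p).symm x)).comp
    ((A ((extChartAt 𝓘(ℝ, 𝔼 d) p).symm x)).comp (coordFrame p x))

variable [RiemannianBundle (fun y : N => TangentSpace 𝓘(ℝ, 𝔼 d) y)]

/-- The Riemannian metric in the coordinates of the preferred chart at `p`. -/
def coordMetric (p : N) (x : 𝔼 d) : 𝔼 d →L[ℝ] 𝔼 d →L[ℝ] ℝ :=
  (innerSL ℝ (E := TangentSpace 𝓘(ℝ, 𝔼 d) ((extChartAt 𝓘(ℝ, 𝔼 d) p).symm x))).bilinearComp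
    (coordFrame p x) (coordFrame p x)

/-- The Riemannian curvature `R(u, v)w` at `p`. -/
def curvature (p : N) (u v w : TangentSpace 𝓘(ℝ, 𝔼 d) p) : TangentSpace 𝓘(ℝ, 𝔼 d) p :=
  coordCurvature (coordMetric p) (extChartAt 𝓘(ℝ, 𝔼 d) p p) u v w

/-- The sectional curvature of the plane spanned by the linearly independent vectors `u`, `v`. -/
def sectionalCurvature (p : N) (u v : TangentSpace 𝓘(ℝ, 𝔼 d) p) : ℝ :=
  inner ℝ (curvature p u v v) u / (inner ℝ u u * inner ℝ v v - inner ℝ u v ^ 2)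

/-- The set of all `k`-Ricci curvatures `Ric_L(X)` at `p`: `L` is a `k`-plane section of the
tangent space, given by an orthonormal basis `e` of `L`, and `X = e i` is a unit vector in `L`;
then `Ric_L(X) = ∑_{j ≠ i} K(e i, e j)`. -/
def kRicciCurvatures (p : N) (k : ℕ) : Set ℝ :=
  {r | ∃ e : Fin k → TangentSpace 𝓘(ℝ, 𝔼 d) p, Orthonormal ℝ e ∧
    ∃ i : Fin k, r = ∑ j ∈ Finset.univ.erase i, sectionalCurvature p (e i) (e j)}

/-- Chen's invariant `Θ_k(p) = (k - 1)⁻¹ inf {Ric_L(X) | L, X}`. -/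
def chenTheta (k : ℕ) (p : N) : ℝ :=
  1 / ((k : ℝ) - 1) * sInf (kRicciCurvatures (d := d) p k)

end Riemannian

/-! ### Quaternionic Kähler manifolds and quaternionic space forms -/

section Quaternionic

variable {d : ℕ} {N : Type*} [TopologicalSpace N] [ChartedSpace (𝔼 d) N]
  [IsManifold 𝓘(ℝ, 𝔼 d) ∞ N]

/-- `J 0, J 1, J 2` is a canonical local basis, on the open set `U`, of the family `σ` of spaces of
endomorphisms: smooth sections over `U` that span `σ` and satisfy the quaternionic relations
(indices modulo 3). -/
structure IsCanonicalLocalBasis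
    (σ : ∀ y : N, Submodule ℝ (TangentSpace 𝓘(ℝ, 𝔼 d) y →L[ℝ] TangentSpace 𝓘(ℝ, 𝔼 d) y))
    (U : Set N)
    (J : Fin 3 → ∀ y : N, TangentSpace 𝓘(ℝ, 𝔼 d) y →L[ℝ] TangentSpace 𝓘(ℝ, 𝔼 d) y) : Prop where
  isOpen : IsOpen U
  smooth : ∀ α, ContMDiffOn 𝓘(ℝ, 𝔼 d) (𝓘(ℝ, 𝔼 d).prod 𝓘(ℝ, 𝔼 d →L[ℝ] 𝔼 d)) ∞
    (fun y => TotalSpace.mk' (𝔼 d →L[ℝ] 𝔼 d)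
      (E := fun y : N => TangentSpace 𝓘(ℝ, 𝔼 d) y →L[ℝ] TangentSpace 𝓘(ℝ, 𝔼 d) y) y (J α y)) U
  span_eq : ∀ y ∈ U, Submodule.span ℝ (Set.range fun α => J α y) = σ y
  sq : ∀ y ∈ U, ∀ α v, J α y (J α y v) = -v
  mul : ∀ y ∈ U, ∀ α v, J α y (J (α + 1) y v) = J (α + 2) y v
  anti : ∀ y ∈ U, ∀ α v, J (α + 1) y (J α y v) = -J (α + 2) y v

/-- `σ` is an almost quaternionic structure: a subbundle of `End(TN)` that has a canonical local
basis around every point. (In positive dimension its rank is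
then 3, by the quaternionic relations.) -/
def IsAlmostQuaternionic
    (σ : ∀ y : N, Submodule ℝ (TangentSpace 𝓘(ℝ, 𝔼 d) y →L[ℝ] TangentSpace 𝓘(ℝ, 𝔼 d) y)) : Prop :=
  ∀ q : N, ∃ U J, q ∈ U ∧ IsCanonicalLocalBasis σ U J

variable [RiemannianBundle (fun y : N => TangentSpace 𝓘(ℝ, 𝔼 d) y)]

/-- The metric is adapted to `σ`: every member of a canonical local basis is an isometry. -/
def IsAdaptedMetric
    (σ : ∀ y : N, Submodule ℝ (TangentSpace 𝓘(ℝ, 𝔼 d) y →L[ℝ] TangentSpace 𝓘(ℝ, 𝔼 d) y)) : Prop :=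
  ∀ U J, IsCanonicalLocalBasis σ U J → ∀ y ∈ U, ∀ α, ∀ v w : TangentSpace 𝓘(ℝ, 𝔼 d) y,
    inner ℝ (J α y v) (J α y w) = inner ℝ v w

/-- `σ` is parallel for the Levi-Civita connection: around every point `q` there are a canonical
local basis `J` and smooth 1-forms `η` with
`∇_u J_α = η_{α+2}(u) J_{α+1} - η_{α+1}(u) J_{α+2}` (indices modulo 3), expressed here in the
coordinates of the preferred chart at `q`, over a set `U` contained in the chart domain. -/
def IsParallelBundle
    (σ : ∀ y : N, Submodule ℝ (TangentSpace 𝓘(ℝ, 𝔼 d) y →L[ℝ] TangentSpace 𝓘(ℝ, 𝔼 d) y)) : Prop :=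
  ∀ q : N, ∃ U J, q ∈ U ∧ U ⊆ (extChartAt 𝓘(ℝ, 𝔼 d) q).source ∧ IsCanonicalLocalBasis σ U J ∧
    ∃ η : Fin 3 → 𝔼 d → 𝔼 d →L[ℝ] ℝ,
      (∀ α, ContDiffOn ℝ ∞ (η α) (extChartAt 𝓘(ℝ, 𝔼 d) q '' U)) ∧
      ∀ x ∈ extChartAt 𝓘(ℝ, 𝔼 d) q '' U, ∀ α, ∀ u v : 𝔼 d,
        coordCovDerivEnd (coordMetric q) (coordEnd (J α) q) x u v =
          η (α + 2) x u • coordEnd (J (α + 1)) q x v - η (α + 1) x u • coordEnd (J (α + 2)) q x v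

/-- `(N, σ, g)` is a quaternionic Kähler manifold. -/
structure IsQuaternionicKaehler
    (σ : ∀ y : N, Submodule ℝ (TangentSpace 𝓘(ℝ, 𝔼 d) y →L[ℝ] TangentSpace 𝓘(ℝ, 𝔼 d) y)) :
    Prop where
  almostQuaternionic : IsAlmostQuaternionic σ
  adapted : IsAdaptedMetric σ
  parallel : IsParallelBundle σ

/-- `Q(X)`, the span of `X` and of all `J X` with `J` in `σ`
(that is, of `X, J₁X, J₂X, J₃X` for any canonical local basis). -/
def quaternionicSpan {q : N}
    (S : Submodule ℝ (TangentSpace 𝓘(ℝ, 𝔼 d) q →L[ℝ] TangentSpace 𝓘(ℝ, 𝔼 d) q))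
    (X : TangentSpace 𝓘(ℝ, 𝔼 d) q) : Submodule ℝ (TangentSpace 𝓘(ℝ, 𝔼 d) q) :=
  Submodule.span ℝ ({X} ∪ {Y | ∃ J ∈ S, J X = Y})

/-- `(N, σ, g)` is a quaternionic space form `N(c)`: a quaternionic Kähler manifold in which every
plane contained in a quaternionic 4-plane `Q(X)` has sectional curvature `c`. -/
structure IsQuaternionicSpaceForm
    (σ : ∀ y : N, Submodule ℝ (TangentSpace 𝓘(ℝ, 𝔼 d) y →L[ℝ] TangentSpace 𝓘(ℝ, 𝔼 d) y))
    (c : ℝ) : Prop where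
  quaternionicKaehler : IsQuaternionicKaehler σ
  sectional : ∀ (q : N) (X : TangentSpace 𝓘(ℝ, 𝔼 d) q), X ≠ 0 →
    ∀ u ∈ quaternionicSpan (σ q) X, ∀ v ∈ quaternionicSpan (σ q) X,
      LinearIndependent ℝ ![u, v] → sectionalCurvature q u v = c

end Quaternionic

/-! ### Submanifolds -/

section Submanifold

variable {n d : ℕ} {M N : Type*}
  [TopologicalSpace M] [ChartedSpace (𝔼 n) M]
  [TopologicalSpace N] [ChartedSpace (𝔼 d) N]

/-- The tangent space of the submanifold `f : M → N` at `p`, inside the tangent space of `N`. -/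
def tangentImage (f : M → N) (p : M) : Submodule ℝ (TangentSpace 𝓘(ℝ, 𝔼 d) (f p)) :=
  LinearMap.range (mfderiv 𝓘(ℝ, 𝔼 n) 𝓘(ℝ, 𝔼 d) f p).toLinearMap

variable [RiemannianBundle (fun y : N => TangentSpace 𝓘(ℝ, 𝔼 d) y)]

/-- `f` is a smooth isometric immersion: the metric of `M` is induced from that of `N`. -/
structure IsIsometricImmersion [RiemannianBundle (fun y : M => TangentSpace 𝓘(ℝ, 𝔼 n) y)]
    (f : M → N) : Prop where
  smooth : ContMDiff 𝓘(ℝ, 𝔼 n) 𝓘(ℝ, 𝔼 d) ∞ f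
  isometric : ∀ (p : M) (u v : TangentSpace 𝓘(ℝ, 𝔼 n) p),
    inner ℝ (mfderiv 𝓘(ℝ, 𝔼 n) 𝓘(ℝ, 𝔼 d) f p u) (mfderiv 𝓘(ℝ, 𝔼 n) 𝓘(ℝ, 𝔼 d) f p v) = inner ℝ u v

/-- The ambient covariant derivative `∇̄_u v` along `f` at `p`, for vector fields `u`, `v` of `M`
that are constant in the preferred chart at `p`: with `F` the expression of `f` in coordinates, it
is `D²F(u, v) + Γ̄(DF u, DF v)`. -/
def ambientCovDeriv (f : M → N) (p : M) (u v : TangentSpace 𝓘(ℝ, 𝔼 n) p) :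
    TangentSpace 𝓘(ℝ, 𝔼 d) (f p) :=
  letI F : 𝔼 n → 𝔼 d := writtenInExtChartAt 𝓘(ℝ, 𝔼 n) 𝓘(ℝ, 𝔼 d) p f
  letI x : 𝔼 n := extChartAt 𝓘(ℝ, 𝔼 n) p p
  (fderiv ℝ (fderiv ℝ F) x u v : 𝔼 d)
    + christoffel (coordMetric (f p)) (F x) (fderiv ℝ F x u) (fderiv ℝ F x v)

/-- The component of `v` normal to the subspace `W`. -/
def normalPart {q : N} (W : Submodule ℝ (TangentSpace 𝓘(ℝ, 𝔼 d) q))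
    (v : TangentSpace 𝓘(ℝ, 𝔼 d) q) : TangentSpace 𝓘(ℝ, 𝔼 d) q :=
  v - W.starProjection v

/-- The second fundamental form `h(u, v)`: the normal part of `∇̄_u v` (Gauss formula). -/
def secondFundamentalForm (f : M → N) (p : M) (u v : TangentSpace 𝓘(ℝ, 𝔼 n) p) :
    TangentSpace 𝓘(ℝ, 𝔼 d) (f p) :=
  normalPart (tangentImage (n := n) f p) (ambientCovDeriv f p u v)

/-- The mean curvature vector `H(p) = (1/n) ∑ h(e_i, e_i)`, with `e` an orthonormal basis of the
tangent space of `M` at `p`. (The value does not depend on the choice of `e`.) -/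
def meanCurvature [RiemannianBundle (fun y : M => TangentSpace 𝓘(ℝ, 𝔼 n) y)]
    (f : M → N) (p : M) : TangentSpace 𝓘(ℝ, 𝔼 d) (f p) :=
  (1 / (n : ℝ)) • ∑ i, secondFundamentalForm f p
    (stdOrthonormalBasis ℝ (TangentSpace 𝓘(ℝ, 𝔼 n) p) i)
    (stdOrthonormalBasis ℝ (TangentSpace 𝓘(ℝ, 𝔼 n) p) i)

/-- The angle between a vector and a subspace: the angle between the vector and its orthogonal
projection (`π / 2` if the projection is zero). -/
def angleWithSubspace {q : N} (v : TangentSpace 𝓘(ℝ, 𝔼 d) q)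
    (W : Submodule ℝ (TangentSpace 𝓘(ℝ, 𝔼 d) q)) : ℝ :=
  InnerProductGeometry.angle v (W.starProjection v)

/-- `M` is a quaternionic submanifold: every section of `σ` carries each tangent space of `M` into
itself. -/
def IsQuaternionicSubmanifold
    (σ : ∀ y : N, Submodule ℝ (TangentSpace 𝓘(ℝ, 𝔼 d) y →L[ℝ] TangentSpace 𝓘(ℝ, 𝔼 d) y))
    (f : M → N) : Prop :=
  ∀ p : M, ∀ J ∈ σ (f p), ∀ v ∈ tangentImage (n := n) f p, J v ∈ tangentImage (n := n) f p

/-- `M` is a totally real submanifold: every section of `σ` carries each tangent space of `M` into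
the normal space. -/
def IsTotallyReal
    (σ : ∀ y : N, Submodule ℝ (TangentSpace 𝓘(ℝ, 𝔼 d) y →L[ℝ] TangentSpace 𝓘(ℝ, 𝔼 d) y))
    (f : M → N) : Prop :=
  ∀ p : M, ∀ J ∈ σ (f p), ∀ v ∈ tangentImage (n := n) f p, ∀ w ∈ tangentImage (n := n) f p,
    inner ℝ w (J v) = 0

variable [IsManifold 𝓘(ℝ, 𝔼 d) ∞ N]

/-- `M` is a slant submanifold with slant angle `θ`: around each of its points there is a canonical
local basis `J` such that, for every nonzero tangent vector `X` at that point and every `α`, the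
angle between `J_α X` and the tangent space of `M` is `θ`. (If this holds for every canonical local
basis, it holds in particular for one, so the condition is the weakest reading of the notion.) -/
def IsSlant
    (σ : ∀ y : N, Submodule ℝ (TangentSpace 𝓘(ℝ, 𝔼 d) y →L[ℝ] TangentSpace 𝓘(ℝ, 𝔼 d) y))
    (f : M → N) (θ : ℝ) : Prop :=
  ∀ p : M, ∃ U J, f p ∈ U ∧ IsCanonicalLocalBasis σ U J ∧
    ∀ α, ∀ X ∈ tangentImage (n := n) f p, X ≠ 0 →
      angleWithSubspace (J α (f p) X) (tangentImage (n := n) f p) = θ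

/-- `M` is a `θ`-slant proper submanifold: slant, and neither quaternionic nor totally real. -/
structure IsProperSlant
    (σ : ∀ y : N, Submodule ℝ (TangentSpace 𝓘(ℝ, 𝔼 d) y →L[ℝ] TangentSpace 𝓘(ℝ, 𝔼 d) y))
    (f : M → N) (θ : ℝ) : Prop where
  slant : IsSlant (n := n) σ f θ
  not_quaternionic : ¬ IsQuaternionicSubmanifold (n := n) σ f
  not_totallyReal : ¬ IsTotallyReal (n := n) σ f

end Submanifold

end QuaternionicSlant

end

/-! Let `e` be an orthonormal basis of the tangent space of `M` at `p`, and let `S` be the sum of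
`K(e_a, e_b)` over ordered pairs `a ≠ b`, which is twice the scalar curvature. The inequality comes
from bounding `S` on both sides and dividing by `n(n-1)`.

Lower bound (`chenTheta_le`): every `k` of the `e_a` span a `k`-plane, so each partial Ricci sum is
at least `(k-1)Θ_k`. Averaging over all permutations of the basis gives `S ≥ n(n-1)Θ_k`.

Upper bound (`sum_curvatureForm_le`): the Gauss equation gives `S = (ambient sum) + n²‖H‖² - ‖h‖²`,
and `‖h‖² ≥ n‖H‖²` by Cauchy-Schwarz. In a quaternionic space form an orthonormal pair has curvature
`c/4 (1 + 3 ∑_α ⟨J_α x, y⟩²)`. The slant condition says that the tangential part of each `J_α e_a`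
has squared length `cos²θ`, so the ambient sum is `c/4 (n(n-1) + 9n cos²θ)`.

The longest part derives that ambient formula (`IsQuaternionTriple.sectional_eq`). Parallelism of
`σ` gives, by the Ricci identity, `[R(x,y), I] = a(x,y) J - b(x,y) K` for some bilinear forms `a`,
`b`. Subtracting `c/4` times the model tensor leaves a curvature-like tensor `D` that vanishes on
every `Q(x)`. Its own commutator forms are then alternating and vanish on each `Q(x)`, and the
quaternion relations force them to be zero. So `D` commutes with `I` and has no holomorphic
sectional curvature, hence no sectional curvature at all, as in Kähler geometry. -/

noncomputable section

set_option maxSynthPendingDepth 3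

namespace QuaternionicSlant

/-! ### Levi-Civita connection in coordinates and the symmetries of its curvature. -/

section Coordinates

variable {E : Type*} [NormedAddCommGroup E] [NormedSpace ℝ E]

theorem hasFDerivAt_apply₂ {F G : Type*} [NormedAddCommGroup F] [NormedSpace ℝ F]
    [NormedAddCommGroup G] [NormedSpace ℝ G] {A : E → F →L[ℝ] F →L[ℝ] G} {x : E}
    (h : DifferentiableAt ℝ A x) (a b : F) :
    HasFDerivAt (fun y => A y a b) (((fderiv ℝ A x).flip a).flip b) x := by
  convert (h.hasFDerivAt.clm_apply (hasFDerivAt_const a x)).clm_apply (hasFDerivAt_const b x) using 1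
  ext
  simp

/-- The Christoffel symbols as a continuous bilinear map. -/
def christoffelCLM (B : E → E →L[ℝ] E →L[ℝ] ℝ) (x : E) : E →L[ℝ] E →L[ℝ] E :=
  (ContinuousLinearMap.compL ℝ E (E →L[ℝ] ℝ) E (ContinuousLinearMap.inverse (B x))).comp
    ((1 / 2 : ℝ) • (fderiv ℝ B x + (fderiv ℝ B x).flip -
      (ContinuousLinearMap.flipₗᵢ ℝ E E ℝ).toContinuousLinearEquiv.toContinuousLinearMap.comp
        (fderiv ℝ B x).flip))

theorem christoffelCLM_apply (B : E → E →L[ℝ] E →L[ℝ] ℝ) (x u v : E) :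
    christoffelCLM B x u v = christoffel B x u v := by
  rfl

/-- `B` is, near `x`, a field of symmetric bilinear forms of class `C³`, nondegenerate at `x`. -/
structure IsMetricAt (B : E → E →L[ℝ] E →L[ℝ] ℝ) (x : E) : Prop where
  contDiffAt : ContDiffAt ℝ 3 B x
  symm : ∀ᶠ y in 𝓝 x, ∀ u v, B y u v = B y v u
  isInvertible : (B x).IsInvertible

namespace IsMetricAt

variable {B : E → E →L[ℝ] E →L[ℝ] ℝ} {x : E}

theorem eventually [CompleteSpace E] (h : IsMetricAt B x) : ∀ᶠ y in 𝓝 x, IsMetricAt B y := by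
  have h1 : ∀ᶠ y in 𝓝 x, (B y).IsInvertible := by
    obtain ⟨e, he⟩ := h.isInvertible
    refine h.contDiffAt.continuousAt.eventually (he ▸ Filter.mem_of_superset e.nhds ?_)
    rintro _ ⟨e', rfl⟩
    exact ⟨e', rfl⟩
  filter_upwards [h.contDiffAt.eventually (by simp), h.symm.eventually_nhds, h1] with y a b c
  exact ⟨a, b, c⟩

theorem differentiableAt (h : IsMetricAt B x) : DifferentiableAt ℝ B x :=
  h.contDiffAt.differentiableAt (by norm_num)

theorem contDiffAt_fderiv (h : IsMetricAt B x) : ContDiffAt ℝ 2 (fderiv ℝ B) x :=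
  h.contDiffAt.fderiv_right (by norm_num)

theorem contDiffAt_christoffelCLM [CompleteSpace E] (h : IsMetricAt B x) :
    ContDiffAt ℝ 2 (christoffelCLM B) x := by
  have h1 : ContDiffAt ℝ 2 (fun y => ContinuousLinearMap.inverse (B y)) x :=
    ContDiffAt.comp x h.isInvertible.contDiffAt_map_inverse (h.contDiffAt.of_le (by norm_num))
  have h2 := h.contDiffAt_fderiv
  have h3 : ContDiffAt ℝ 2 (fun y => (fderiv ℝ B y).flip) x :=
    (ContinuousLinearMap.flipₗᵢ ℝ E E (E →L[ℝ] ℝ)).toContinuousLinearEquiv.contDiff.contDiffAt.comp x h2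
  unfold christoffelCLM
  refine ContDiffAt.clm_comp ?_ ?_
  · exact (ContinuousLinearMap.contDiff _).contDiffAt.comp x h1
  · refine ContDiffAt.const_smul _ (ContDiffAt.sub (h2.add h3) (contDiffAt_const.clm_comp h3))

theorem differentiableAt_christoffelCLM [CompleteSpace E] (h : IsMetricAt B x) :
    DifferentiableAt ℝ (christoffelCLM B) x :=
  h.contDiffAt_christoffelCLM.differentiableAt (by norm_num)

theorem apply_christoffel (h : IsMetricAt B x) (u v w : E) :
    B x (christoffelCLM B x u v) w = koszul B x u v w := by
  rw [christoffelCLM_apply, christoffel, h.isInvertible.self_apply_inverse]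

theorem koszul_apply (B : E → E →L[ℝ] E →L[ℝ] ℝ) (x u v w : E) : koszul B x u v w =
    1 / 2 * (fderiv ℝ B x u v w + fderiv ℝ B x v u w - fderiv ℝ B x w u v) := by
  simp [koszul]

theorem apply_comm (h : IsMetricAt B x) (u v : E) : B x u v = B x v u := h.symm.self_of_nhds u v

theorem fderiv_comm (h : IsMetricAt B x) (u v w : E) :
    fderiv ℝ B x u v w = fderiv ℝ B x u w v := by
  have e : (fun y => B y v w) =ᶠ[𝓝 x] fun y => B y w v := by
    filter_upwards [h.symm] with y hy using hy v w
  have h1 := hasFDerivAt_apply₂ h.differentiableAt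
  have := (h1 v w).unique ((h1 w v).congr_of_eventuallyEq e)
  simpa using DFunLike.congr_fun this u

/-- Metric compatibility, `∇B = 0`: of the six derivatives in the two Koszul formulas, four cancel
and two agree. -/
theorem fderiv_eq (h : IsMetricAt B x) (u v w : E) : fderiv ℝ B x u v w =
    B x (christoffelCLM B x u v) w + B x v (christoffelCLM B x u w) := by
  rw [h.apply_comm v, h.apply_christoffel, h.apply_christoffel, koszul_apply, koszul_apply,
    h.fderiv_comm u w v, h.fderiv_comm v u w, h.fderiv_comm w u v]
  ring

theorem christoffel_comm (h : IsMetricAt B x) (u v : E) :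
    christoffelCLM B x u v = christoffelCLM B x v u := by
  apply h.isInvertible.injective
  ext w
  rw [h.apply_christoffel, h.apply_christoffel, koszul_apply, koszul_apply, h.fderiv_comm w u v]
  ring

theorem fderiv_christoffel_comm [CompleteSpace E] (h : IsMetricAt B x) (u v w : E) :
    fderiv ℝ (christoffelCLM B) x u v w = fderiv ℝ (christoffelCLM B) x u w v := by
  have e : (fun y => christoffelCLM B y v w) =ᶠ[𝓝 x] fun y => christoffelCLM B y w v := by
    filter_upwards [h.eventually] with y hy using hy.christoffel_comm v w
  have h1 := hasFDerivAt_apply₂ h.differentiableAt_christoffelCLM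
  have := (h1 v w).unique ((h1 w v).congr_of_eventuallyEq e)
  simpa using DFunLike.congr_fun this u

theorem coordCurvature_eq [CompleteSpace E] (h : IsMetricAt B x) (u v w : E) :
    coordCurvature B x u v w =
      fderiv ℝ (christoffelCLM B) x u v w - fderiv ℝ (christoffelCLM B) x v u w
      + christoffelCLM B x u (christoffelCLM B x v w)
      - christoffelCLM B x v (christoffelCLM B x u w) := by
  have h1 (a b : E) := (hasFDerivAt_apply₂ h.differentiableAt_christoffelCLM a b).fderiv
  simp only [christoffelCLM_apply] at h1
  simp only [coordCurvature, h1]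
  rfl

theorem coordCurvature_swap (u v w : E) :
    coordCurvature B x u v w = -coordCurvature B x v u w := by
  simp only [coordCurvature]; abel

theorem coordCurvature_cyclic [CompleteSpace E] (h : IsMetricAt B x) (u v w : E) :
    coordCurvature B x u v w + coordCurvature B x v w u + coordCurvature B x w u v = 0 := by
  simp only [h.coordCurvature_eq]
  rw [h.christoffel_comm w v, h.christoffel_comm w u, h.christoffel_comm v u,
    h.fderiv_christoffel_comm u w v, h.fderiv_christoffel_comm v w u,
    h.fderiv_christoffel_comm u v w, h.fderiv_christoffel_comm w v u]
  abel

/-- Differentiate metric compatibility once more and antisymmetrize in `u`, `v`. The second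
derivatives of `B` cancel by symmetry, and what is left is the curvature acting on `B`. -/
theorem coordCurvature_skew [CompleteSpace E] (h : IsMetricAt B x) (u v w z : E) :
    B x (coordCurvature B x u v w) z = - B x (coordCurvature B x u v z) w := by
  set Γ := christoffelCLM B with hΓ
  have key : ∀ u v, fderiv ℝ (fderiv ℝ B) x u v w z =
      fderiv ℝ B x u (Γ x v w) z + B x (fderiv ℝ Γ x u v w) z
      + (fderiv ℝ B x u w (Γ x v z) + B x w (fderiv ℝ Γ x u v z)) := by
    intro u v
    have e : (fun y => fderiv ℝ B y v w z) =ᶠ[𝓝 x]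
        fun y => B y (Γ y v w) z + B y w (Γ y v z) := by
      filter_upwards [h.eventually] with y hy using hy.fderiv_eq v w z
    have c (a : E) := hasFDerivAt_const (𝕜 := ℝ) a x
    have d1 := (((h.contDiffAt_fderiv.differentiableAt (by norm_num)).hasFDerivAt.clm_apply
      (c v)).clm_apply (c w)).clm_apply (c z)
    have dB := h.differentiableAt.hasFDerivAt
    have dΓ (a : E) := (h.differentiableAt_christoffelCLM.hasFDerivAt.clm_apply (c v)).clm_apply (c a)
    have d2 := ((dB.clm_apply (dΓ w)).clm_apply (c z)).add ((dB.clm_apply (c w)).clm_apply (dΓ z))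
    have := DFunLike.congr_fun (d1.unique (d2.congr_of_eventuallyEq e)) u
    simpa [add_comm, hΓ] using this
  have hs := (h.contDiffAt.isSymmSndFDerivAt (by simp; norm_num)).eq u v
  have := congrArg (fun A : E →L[ℝ] E →L[ℝ] ℝ => A w z) hs
  simp only [key, h.fderiv_eq] at this
  simp only [h.coordCurvature_eq, ← hΓ] at *
  simp only [map_add, map_sub, add_apply, sub_apply]
  rw [h.apply_comm _ z] at this
  simp only [h.apply_comm w] at this
  simp only [h.apply_comm z, h.apply_comm (Γ x v w) (Γ x u z)] at *
  linarith

end IsMetricAt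

end Coordinates

/-! ### Ricci identity for a parallel family of endomorphisms, and the Gauss equation in
coordinates. -/

section Coordinates

variable {E : Type*} [NormedAddCommGroup E] [NormedSpace ℝ E]
variable {B : E → E →L[ℝ] E →L[ℝ] ℝ} {x : E}

/-- The Ricci identity for a family of endomorphism fields whose span is parallel. -/
theorem IsMetricAt.coordCurvature_comm [CompleteSpace E] (h : IsMetricAt B x)
    {A : Fin 3 → E → E →L[ℝ] E} {η : Fin 3 → E → E →L[ℝ] ℝ}
    (hA : ∀ α, ContDiffAt ℝ 2 (A α) x) (hη : ∀ α, DifferentiableAt ℝ (η α) x)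
    (hpar : ∀ᶠ y in 𝓝 x, ∀ α, ∀ u v : E, coordCovDerivEnd B (A α) y u v =
      η (α + 2) y u • A (α + 1) y v - η (α + 1) y u • A (α + 2) y v) :
    ∃ ρ : Fin 3 → E →L[ℝ] E →L[ℝ] ℝ, ∀ u v w,
      coordCurvature B x u v (A 0 x w) - A 0 x (coordCurvature B x u v w) =
        ρ 2 u v • A 1 x w - ρ 1 u v • A 2 x w := by
  set Γ := christoffelCLM B with hΓ
  have hD : ∀ᶠ y in 𝓝 x, ∀ α, ∀ u v : E, fderiv ℝ (A α) y u v =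
      η (α + 2) y u • A (α + 1) y v - η (α + 1) y u • A (α + 2) y v
        - Γ y u (A α y v) + A α y (Γ y u v) := by
    filter_upwards [hpar] with y hy α u v
    rw [← hy, coordCovDerivEnd, hΓ, christoffelCLM_apply, christoffelCLM_apply]
    abel
  have hDx := hD.self_of_nhds
  have key : ∀ u v w, fderiv ℝ (fderiv ℝ (A 0)) x u v w =
      (fderiv ℝ (η 2) x u v • A 1 x w + η 2 x v • fderiv ℝ (A 1) x u w)
      - (fderiv ℝ (η 1) x u v • A 2 x w + η 1 x v • fderiv ℝ (A 2) x u w)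
      - (fderiv ℝ Γ x u v (A 0 x w) + Γ x v (fderiv ℝ (A 0) x u w))
      + (fderiv ℝ (A 0) x u (Γ x v w) + A 0 x (fderiv ℝ Γ x u v w)) := by
    intro u v w
    have e : (fun y => fderiv ℝ (A 0) y v w) =ᶠ[𝓝 x] fun y =>
      η 2 y v • A 1 y w - η 1 y v • A 2 y w - Γ y v (A 0 y w) + A 0 y (Γ y v w) := by
      filter_upwards [hD] with y hy using hy 0 v w
    have c (a : E) := hasFDerivAt_const (𝕜 := ℝ) a x
    have d1 := ((((hA 0).fderiv_right (m := 1) (by norm_num)).differentiableAt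
      (by norm_num)).hasFDerivAt.clm_apply (c v)).clm_apply (c w)
    have dA (α) := ((hA α).differentiableAt (by norm_num)).hasFDerivAt
    have dη (α) := (hη α).hasFDerivAt.clm_apply (c v)
    have dΓ := h.differentiableAt_christoffelCLM.hasFDerivAt.clm_apply (c v)
    have d2 := ((((dη 2).smul ((dA 1).clm_apply (c w))).sub
      ((dη 1).smul ((dA 2).clm_apply (c w)))).sub (dΓ.clm_apply ((dA 0).clm_apply (c w)))).add
      ((dA 0).clm_apply (dΓ.clm_apply (c w)))
    have := DFunLike.congr_fun (d1.unique (d2.congr_of_eventuallyEq e)) u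
    simp [← hΓ] at this
    rw [this]
    abel
  -- These are the curvature forms `dη_α + η_{α+1} ∧ η_{α+2}` of the connection induced on `σ`. The
  -- identity is `key` antisymmetrized in `u`, `v`, the second derivative of `A 0` being symmetric.
  refine ⟨fun α => fderiv ℝ (η α) x - (fderiv ℝ (η α) x).flip +
    ((η (α + 1) x).smulRight (η (α + 2) x) - (η (α + 2) x).smulRight (η (α + 1) x)), fun u v w => ?_⟩
  have hs := ((hA 0).isSymmSndFDerivAt (by simp)).eq u v
  have hs := congrArg (fun A : E →L[ℝ] E => A w) hs
  simp only [key, hDx] at hs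
  simp only [h.coordCurvature_eq, ← hΓ]
  simp only [map_add, map_sub, map_smul, add_apply, sub_apply, ContinuousLinearMap.flip_apply,
    ContinuousLinearMap.smulRight_apply, smul_apply] at hs ⊢
  simp only [Fin.isValue, Fin.reduceAdd, smul_eq_mul] at hs ⊢
  rw [← sub_eq_zero] at hs ⊢
  refine (neg_eq_zero.mp ?_)
  rw [← hs]
  module

variable {E' : Type*} [NormedAddCommGroup E'] [NormedSpace ℝ E']
variable {B' : E' → E' →L[ℝ] E' →L[ℝ] ℝ} {F : E → E'}

/-- The covariant derivative along the map `F` of the images of constant vector fields. -/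
def covDerivAlong (B' : E' → E' →L[ℝ] E' →L[ℝ] ℝ) (F : E → E') (x u v : E) : E' :=
  fderiv ℝ (fderiv ℝ F) x u v + christoffelCLM B' (F x) (fderiv ℝ F x u) (fderiv ℝ F x v)

theorem covDerivAlong_comm (h' : IsMetricAt B' (F x)) (hF : ContDiffAt ℝ 2 F x) (u v : E) :
    covDerivAlong B' F x u v = covDerivAlong B' F x v u := by
  rw [covDerivAlong, covDerivAlong, (hF.isSymmSndFDerivAt (by simp)).eq u v, h'.christoffel_comm]

/-- The tangential part of the ambient derivative is the intrinsic one: differentiating the isometry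
relation turns the Koszul formula of `B` into that of `B'` plus second derivatives of `F`, which
cancel by symmetry except for one. -/
theorem apply_covDerivAlong (h : IsMetricAt B x) (h' : IsMetricAt B' (F x))
    (hF : ContDiffAt ℝ 3 F x)
    (hiso : ∀ᶠ y in 𝓝 x, ∀ u v, B y u v = B' (F y) (fderiv ℝ F y u) (fderiv ℝ F y v))
    (u v w : E) :
    B' (F x) (covDerivAlong B' F x u v) (fderiv ℝ F x w) = B x (christoffelCLM B x u v) w := by
  have key : ∀ u v w, fderiv ℝ B x u v w =
      fderiv ℝ B' (F x) (fderiv ℝ F x u) (fderiv ℝ F x v) (fderiv ℝ F x w)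
      + B' (F x) (fderiv ℝ (fderiv ℝ F) x u v) (fderiv ℝ F x w)
      + B' (F x) (fderiv ℝ F x v) (fderiv ℝ (fderiv ℝ F) x u w) := by
    intro u v w
    have e : (fun y => B y v w) =ᶠ[𝓝 x]
        fun y => B' (F y) (fderiv ℝ F y v) (fderiv ℝ F y w) := by
      filter_upwards [hiso] with y hy using hy v w
    have c (a : E) := hasFDerivAt_const (𝕜 := ℝ) a x
    have dF := (hF.differentiableAt (by norm_num)).hasFDerivAt
    have dF' (a) := ((hF.fderiv_right (m := 2) (by norm_num)).differentiableAt
      (by norm_num)).hasFDerivAt.clm_apply (c a)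
    have d2 := ((h'.differentiableAt.hasFDerivAt.comp x dF).clm_apply (dF' v)).clm_apply (dF' w)
    have := DFunLike.congr_fun
      ((hasFDerivAt_apply₂ h.differentiableAt v w).unique (d2.congr_of_eventuallyEq e)) u
    simp at this
    rw [this]
    ring
  have hs (u v) := (hF.isSymmSndFDerivAt (by simp; norm_num)).eq u v
  rw [h.apply_christoffel, IsMetricAt.koszul_apply, key, key, key, covDerivAlong, map_add,
    add_apply, h'.apply_christoffel, IsMetricAt.koszul_apply, hs v u, hs w u, hs w v,
    h'.apply_comm (fderiv ℝ F x v), h'.apply_comm (fderiv ℝ F x u)]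
  ring

/-- The Gauss equation in coordinates. -/
theorem gauss_coord [CompleteSpace E] [CompleteSpace E'] (h : IsMetricAt B x)
    (h' : IsMetricAt B' (F x)) (hF : ContDiffAt ℝ 3 F x)
    (hiso : ∀ᶠ y in 𝓝 x, ∀ u v, B y u v = B' (F y) (fderiv ℝ F y u) (fderiv ℝ F y v))
    (u v w z : E) :
    B x (coordCurvature B x u v w) z =
      B' (F x) (coordCurvature B' (F x) (fderiv ℝ F x u) (fderiv ℝ F x v) (fderiv ℝ F x w))
        (fderiv ℝ F x z)
      + B' (F x) (covDerivAlong B' F x v w) (covDerivAlong B' F x u z)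
      - B' (F x) (covDerivAlong B' F x u w) (covDerivAlong B' F x v z)
      - B x (christoffelCLM B x v w) (christoffelCLM B x u z)
      + B x (christoffelCLM B x u w) (christoffelCLM B x v z) := by
  set Γ := christoffelCLM B with hΓ
  set Γ' := christoffelCLM B' with hΓ'
  set D := fderiv ℝ F with hD
  set D2 := fderiv ℝ D with hD2
  have hFe : ∀ᶠ y in 𝓝 x, IsMetricAt B' (F y) := hF.continuousAt.eventually h'.eventually
  have hev : ∀ᶠ y in 𝓝 x, ∀ v w z, B' (F y) (D2 y v w + Γ' (F y) (D y v) (D y w)) (D y z) =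
      B y (Γ y v w) z := by
    filter_upwards [h.eventually, hFe, hF.eventually (by simp), hiso.eventually_nhds]
      with y a b c d v w z using apply_covDerivAlong a b c d v w z
  have dF := (hF.differentiableAt (by norm_num)).hasFDerivAt
  have cD : ContDiffAt ℝ 2 D x := hF.fderiv_right (by norm_num)
  have dD := (cD.differentiableAt (by norm_num)).hasFDerivAt
  have dD2 := ((cD.fderiv_right (m := 1) (by norm_num)).differentiableAt (by norm_num)).hasFDerivAt
  -- The derivative in direction `u` of `B'(∇̄_v w, DF z) = B(∇_v w, z)`. Antisymmetrizing in `u`,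
  -- `v` removes the third derivative of `F` and produces both curvatures.
  have key : ∀ u v w z,
      fderiv ℝ B x u (Γ x v w) z + B x (fderiv ℝ Γ x u v w) z =
      fderiv ℝ B' (F x) (D x u) (covDerivAlong B' F x v w) (D x z)
      + B' (F x) (fderiv ℝ D2 x u v w + fderiv ℝ Γ' (F x) (D x u) (D x v) (D x w)
        + Γ' (F x) (D2 x u v) (D x w) + Γ' (F x) (D x v) (D2 x u w)) (D x z)
      + B' (F x) (covDerivAlong B' F x v w) (D2 x u z) := by
    intro u v w z
    have e : (fun y => B' (F y) (D2 y v w + Γ' (F y) (D y v) (D y w)) (D y z)) =ᶠ[𝓝 x]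
        fun y => B y (Γ y v w) z := by
      filter_upwards [hev] with y hy using hy v w z
    have c (a : E) := hasFDerivAt_const (𝕜 := ℝ) a x
    have dΓ := (h.differentiableAt_christoffelCLM.hasFDerivAt.clm_apply (c v)).clm_apply (c w)
    have d1 := (h.differentiableAt.hasFDerivAt.clm_apply dΓ).clm_apply (c z)
    have dΓ' := ((h'.differentiableAt_christoffelCLM.hasFDerivAt.comp x dF).clm_apply
      (dD.clm_apply (c v))).clm_apply (dD.clm_apply (c w))
    have d2 := ((h'.differentiableAt.hasFDerivAt.comp x dF).clm_apply
      (((dD2.clm_apply (c v)).clm_apply (c w)).add dΓ')).clm_apply (dD.clm_apply (c z))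
    have := DFunLike.congr_fun (d1.unique (d2.congr_of_eventuallyEq e.symm)) u
    simp [← hΓ, ← hΓ', ← hD, ← hD2] at this
    simp only [covDerivAlong, ← hΓ', ← hD, ← hD2, map_add, add_apply]
    linarith
  have hA (u v z) : B' (F x) (covDerivAlong B' F x u v) (D x z) = B x (Γ x u v) z :=
    apply_covDerivAlong h h' hF hiso u v z
  have hs := (hF.isSymmSndFDerivAt (by simp; norm_num)).eq
  have hs3 := (cD.isSymmSndFDerivAt (by simp)).eq
  rw [← hD] at hs
  rw [← hD2] at hs hs3
  have k1 := key u v w z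
  have k2 := key v u w z
  have f1 (a b u z) : B' (F x) (covDerivAlong B' F x a b) (covDerivAlong B' F x u z) =
      B' (F x) (covDerivAlong B' F x a b) (D2 x u z)
      + B' (F x) (covDerivAlong B' F x a b) (Γ' (F x) (D x u) (D x z)) :=
    map_add (B' (F x) (covDerivAlong B' F x a b)) _ _
  have f2 (u v w) : B' (F x) (Γ' (F x) (D x u) (covDerivAlong B' F x v w)) (D x z) =
      B' (F x) (Γ' (F x) (D x u) (D2 x v w)) (D x z)
      + B' (F x) (Γ' (F x) (D x u) (Γ' (F x) (D x v) (D x w))) (D x z) := by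
    simp only [covDerivAlong, ← hΓ', ← hD, ← hD2, map_add, add_apply]
  rw [h.fderiv_eq, h'.fderiv_eq] at k1 k2
  rw [hs3 v u, hs v u] at k2
  rw [f1, f1, h.coordCurvature_eq, h'.coordCurvature_eq]
  simp only [map_add, map_sub, add_apply, sub_apply, ← hΓ, ← hΓ'] at k1 k2 ⊢
  linarith [f2 u v w, f2 v u w]

end Coordinates

theorem exists_of_mem_span_quadruple {V : Type*} [AddCommGroup V] [Module ℝ V] {x y z w u : V} (hu : u ∈ Submodule.span ℝ {x, y, z, w}) :
    ∃ a b c d : ℝ, u = a • x + b • y + c • z + d • w := by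
  rw [Submodule.mem_span_insert] at hu
  obtain ⟨a, v, hv, rfl⟩ := hu
  rw [Submodule.mem_span_triple] at hv
  obtain ⟨b, c, d, rfl⟩ := hv
  exact ⟨a, b, c, d, by abel⟩

/-! ### Algebra of curvature-like tensors. -/

section CurvatureAlgebra

variable {V : Type*} [AddCommGroup V] [Module ℝ V]

/-- Algebraic curvature tensors. -/
structure IsCurvatureLike (T : V → V → V → V → ℝ) : Prop where
  add_left : ∀ a b y z w, T (a + b) y z w = T a y z w + T b y z w
  smul_left : ∀ (r : ℝ) x y z w, T (r • x) y z w = r * T x y z w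
  swap : ∀ x y z w, T x y z w = -T y x z w
  skew : ∀ x y z w, T x y z w = -T x y w z
  cyclic : ∀ x y z w, T x y z w + T y z x w + T z x y w = 0

namespace IsCurvatureLike

variable {T S : V → V → V → V → ℝ}

theorem sub (hT : IsCurvatureLike T) (hS : IsCurvatureLike S) :
    IsCurvatureLike fun x y z w => T x y z w - S x y z w where
  add_left a b y z w := by rw [hT.add_left, hS.add_left]; ring
  smul_left r x y z w := by rw [hT.smul_left, hS.smul_left]; ring
  swap x y z w := by rw [hT.swap, hS.swap]; ring
  skew x y z w := by rw [hT.skew, hS.skew]; ring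
  cyclic x y z w := by linarith [hT.cyclic x y z w, hS.cyclic x y z w]

variable (hT : IsCurvatureLike T)
include hT

/-- The octahedron argument: combine the four cyclic identities on `x, y, z, w` with the two skew
symmetries. -/
theorem pair (x y z w : V) : T x y z w = T z w x y := by
  linarith [hT.cyclic x y z w, hT.cyclic y z w x, hT.cyclic z w x y, hT.cyclic w x y z,
    hT.swap y z x w, hT.swap z w y x, hT.swap w x z y, hT.swap x y w z,
    hT.skew x y z w, hT.skew y z x w, hT.skew z x y w, hT.skew z w x y, hT.skew w x y z,
    hT.skew w x z y, hT.skew w y x z, hT.skew y w z x, hT.swap x z w y, hT.swap w y x z,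
    hT.skew x z w y, hT.skew z w y x, hT.skew y z w x,
    hT.swap z x y w, hT.swap w y z x]

theorem add_right (x a b z w) : T x (a + b) z w = T x a z w + T x b z w := by
  rw [hT.swap, hT.add_left, hT.swap a, hT.swap b]; ring

theorem smul_right (r : ℝ) (x y z w) : T x (r • y) z w = r * T x y z w := by
  rw [hT.swap, hT.smul_left, hT.swap y]; ring

theorem neg_left (x y z w) : T (-x) y z w = -T x y z w := by
  simpa using hT.smul_left (-1) x y z w

theorem neg_right (x y z w) : T x (-y) z w = -T x y z w := by
  simpa using hT.smul_right (-1) x y z w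

theorem add_third (x y a b w) : T x y (a + b) w = T x y a w + T x y b w := by
  rw [hT.pair, hT.add_left, hT.pair a, hT.pair b]

theorem smul_third (r : ℝ) (x y z w) : T x y (r • z) w = r * T x y z w := by
  rw [hT.pair, hT.smul_left, hT.pair z]

theorem neg_third (x y z w) : T x y (-z) w = -T x y z w := by
  simpa using hT.smul_third (-1) x y z w

theorem add_fourth (x y z a b) : T x y z (a + b) = T x y z a + T x y z b := by
  rw [hT.pair, hT.add_right, hT.pair z a, hT.pair z b]

theorem smul_fourth (r : ℝ) (x y z w) : T x y z (r • w) = r * T x y z w := by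
  rw [hT.pair, hT.smul_right, hT.pair z w]

theorem neg_fourth (x y z w) : T x y z (-w) = -T x y z w := by
  simpa using hT.smul_fourth (-1) x y z w

/-- A curvature-like tensor whose sectional curvatures vanish on a subspace vanishes there. -/
theorem eq_zero_of_sectional (W : Submodule ℝ V) (h : ∀ x ∈ W, ∀ y ∈ W, T x y y x = 0) :
    ∀ x ∈ W, ∀ y ∈ W, ∀ z ∈ W, ∀ w ∈ W, T x y z w = 0 := by
  -- Polarization in the middle pair; `h2` then polarizes in the outer pair.
  have h1 : ∀ x ∈ W, ∀ y ∈ W, ∀ z ∈ W, T x y z x = 0 := by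
    intro x hx y hy z hz
    have := h x hx (y + z) (W.add_mem hy hz)
    rw [hT.add_right, hT.add_third, hT.add_third, h x hx y hy, h x hx z hz] at this
    have e : T x z y x = T x y z x := by rw [hT.pair, hT.swap, hT.skew]; ring
    linarith
  have h2 : ∀ x ∈ W, ∀ y ∈ W, ∀ z ∈ W, ∀ w ∈ W, T x y z w = -T w y z x := by
    intro x hx y hy z hz w hw
    have := h1 (x + w) (W.add_mem hx hw) y hy z hz
    rw [hT.add_left, hT.add_fourth, hT.add_fourth, h1 x hx y hy z hz, h1 w hw y hy z hz] at this
    linarith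
  -- By now `T` is alternating in all four arguments, so the three terms of the cyclic identity are
  -- equal and `3T = 0`.
  intro x hx y hy z hz w hw
  linarith [h2 x hx y hy z hz w hw, h2 y hy z hz x hx w hw, h2 z hz x hx y hy w hw,
    hT.cyclic x y z w, hT.swap x y z w, hT.swap y z x w, hT.swap z x y w,
    hT.skew x y z w, hT.skew y z x w, hT.skew z x y w, hT.pair x y z w, hT.pair y z x w,
    hT.pair z x y w, hT.swap w z x y, hT.swap w x y z, hT.swap w y z x]

/-- A curvature-like tensor that commutes with a complex structure and has vanishing holomorphic
sectional curvature has vanishing sectional curvature. -/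
theorem sectional_eq_zero_of_complex (I : V →ₗ[ℝ] V) (hI : ∀ v, I (I v) = -v)
    (hTI : ∀ x y z w, T x y (I z) (I w) = T x y z w) (h : ∀ x, T x (I x) (I x) x = 0) (x y : V) :
    T x y y x = 0 := by
  have hTI' : ∀ x y z w, T (I x) (I y) z w = T x y z w := fun x y z w => by
    rw [hT.pair, hTI, hT.pair]
  -- Polarize the vanishing holomorphic curvature at `x + y` and `x - y`, reducing mixed terms by
  -- `I`-invariance and the cyclic identity. Using this for `y` and then for `I y` gives `T = 9T`.
  have key : ∀ x y, T x y y x = -3 * T x (I y) (I y) x := by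
    intro x y
    have hp := h (x + y)
    have hm := h (x - y)
    rw [sub_eq_add_neg] at hm
    simp only [map_add, map_neg, hT.add_left, hT.add_right, hT.add_third, hT.add_fourth,
      hT.neg_left, hT.neg_right, hT.neg_third, hT.neg_fourth, h] at hp hm
    have b1 : T x (I y) (I x) y = T x (I y) (I y) x := by
      have := hTI x (I y) (I x) y
      rw [hI, hT.neg_third, hT.skew] at this
      linarith
    have b2 : T y (I x) (I x) y = T x (I y) (I y) x := by
      have e1 := hTI' y (I x) (I x) y
      rw [hI, hT.neg_right, hT.swap] at e1
      linarith
    have b3 : T y (I x) (I y) x = T x (I y) (I y) x := by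
      have e1 := hTI' y (I x) (I y) x
      rw [hI, hT.neg_right, hT.swap] at e1
      linarith
    have a1 : T y (I y) (I x) x = T x (I x) (I y) y := by
      rw [hT.pair, hT.swap, hT.skew, neg_neg]
    have c1 := hT.cyclic x (I x) (I y) y
    have c2 : T (I x) (I y) x y = - T x y y x := by rw [hTI', hT.skew]
    have c3 : T (I y) x (I x) y = - T x (I y) (I x) y := hT.swap _ _ _ _
    linarith
  have k1 := key x y
  have k2 := key x (I y)
  rw [hI, hT.neg_right, hT.neg_third] at k2
  linarith

end IsCurvatureLike

end CurvatureAlgebra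

/-! ### Curvature tensors of quaternionic space form type. -/

section QuaternionicAlgebra

variable {V : Type*} [NormedAddCommGroup V] [InnerProductSpace ℝ V]

/-- Skew-adjoint operators satisfying the relations of the imaginary quaternions. -/
structure IsQuaternionTriple (I J K : V →ₗ[ℝ] V) : Prop where
  skewI : ∀ v w, inner ℝ (I v) w = -inner ℝ v (I w)
  skewJ : ∀ v w, inner ℝ (J v) w = -inner ℝ v (J w)
  skewK : ∀ v w, inner ℝ (K v) w = -inner ℝ v (K w)
  II : ∀ v, I (I v) = -v
  JJ : ∀ v, J (J v) = -v
  KK : ∀ v, K (K v) = -v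
  IJ : ∀ v, I (J v) = K v
  JK : ∀ v, J (K v) = I v
  KI : ∀ v, K (I v) = J v
  JI : ∀ v, J (I v) = -K v
  KJ : ∀ v, K (J v) = -I v
  IK : ∀ v, I (K v) = -J v

/-- The curvature tensor of the quaternionic space form with `c = 4`. -/
def modelCurvature (I J K : V →ₗ[ℝ] V) (x y z w : V) : ℝ :=
  inner ℝ y z * inner ℝ x w - inner ℝ x z * inner ℝ y w
  + (inner ℝ (I y) z * inner ℝ (I x) w - inner ℝ (I x) z * inner ℝ (I y) w
    - 2 * inner ℝ (I x) y * inner ℝ (I z) w)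
  + (inner ℝ (J y) z * inner ℝ (J x) w - inner ℝ (J x) z * inner ℝ (J y) w
    - 2 * inner ℝ (J x) y * inner ℝ (J z) w)
  + (inner ℝ (K y) z * inner ℝ (K x) w - inner ℝ (K x) z * inner ℝ (K y) w
    - 2 * inner ℝ (K x) y * inner ℝ (K z) w)

namespace IsQuaternionTriple

variable {I J K : V →ₗ[ℝ] V} (h : IsQuaternionTriple I J K)
include h

theorem swapI (v w : V) : inner ℝ (I v) w = -inner ℝ (I w) v := by
  rw [h.skewI, real_inner_comm]

theorem swapJ (v w : V) : inner ℝ (J v) w = -inner ℝ (J w) v := by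
  rw [h.skewJ, real_inner_comm]

theorem swapK (v w : V) : inner ℝ (K v) w = -inner ℝ (K w) v := by
  rw [h.skewK, real_inner_comm]

theorem isCurvatureLike (r : ℝ) :
    IsCurvatureLike fun x y z w => r * modelCurvature I J K x y z w where
  add_left a b y z w := by simp only [modelCurvature, map_add, inner_add_left]; ring
  smul_left r x y z w := by
    simp only [modelCurvature, map_smul, real_inner_smul_left]; ring
  swap x y z w := by
    simp only [modelCurvature, h.swapI x y, h.swapJ x y, h.swapK x y]; ring
  skew x y z w := by
    simp only [modelCurvature, h.swapI w z, h.swapJ w z, h.swapK w z]; ring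
  cyclic x y z w := by
    simp only [modelCurvature, h.swapI y x, h.swapJ y x, h.swapK y x, h.swapI z y, h.swapJ z y,
      h.swapK z y, h.swapI z x, h.swapJ z x, h.swapK z x, real_inner_comm x y,
      real_inner_comm x z, real_inner_comm y z]
    ring

/-- The commutator of the model curvature with `I`; it dictates the corrections `c⟨K x, y⟩` and `c⟨J
x, y⟩` in the forms `a'`, `b'` of `sectional_eq`. -/
theorem modelCurvature_comm (x y z w : V) :
    modelCurvature I J K x y (I z) w + modelCurvature I J K x y z (I w) =
      4 * inner ℝ (J x) y * inner ℝ (K z) w - 4 * inner ℝ (K x) y * inner ℝ (J z) w := by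
  have e1 (a b : V) : inner ℝ a (I b) = -inner ℝ (I a) b := by rw [h.skewI]; ring
  simp only [modelCurvature, e1, h.II, h.IJ, h.IK, h.JI, h.KI, inner_neg_left]
  ring

theorem inner_self (v : V) : inner ℝ v (I v) = 0 ∧ inner ℝ v (J v) = 0 ∧ inner ℝ v (K v) = 0 := by
  refine ⟨?_, ?_, ?_⟩
  · linarith [h.skewI v v, real_inner_comm v (I v)]
  · linarith [h.skewJ v v, real_inner_comm v (J v)]
  · linarith [h.skewK v v, real_inner_comm v (K v)]

theorem inner_mixed (v : V) :
    inner ℝ (I v) (I v) = inner ℝ v v ∧ inner ℝ (J v) (J v) = inner ℝ v v ∧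
    inner ℝ (K v) (K v) = inner ℝ v v ∧ inner ℝ (I v) (J v) = 0 ∧ inner ℝ (I v) (K v) = 0 ∧
    inner ℝ (J v) (K v) = 0 := by
  obtain ⟨h1, h2, h3⟩ := h.inner_self v
  refine ⟨?_, ?_, ?_, ?_, ?_, ?_⟩
  · rw [h.skewI, h.II, inner_neg_right, neg_neg]
  · rw [h.skewJ, h.JJ, inner_neg_right, neg_neg]
  · rw [h.skewK, h.KK, inner_neg_right, neg_neg]
  · rw [h.skewI, h.IJ, h3, neg_zero]
  · rw [h.skewI, h.IK, inner_neg_right, h2]; simp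
  · rw [h.skewJ, h.JK, h1, neg_zero]

/-- Inside `Q(x)` the vectors `u, I u, J u, K u` are orthogonal of equal length, so the squares of
their products with `v` add up to `|u|²|v|²` (Euler's four-square identity). This turns `3 ∑ ⟨J_α u,
v⟩²` into three more copies of the Gram determinant. -/
theorem modelCurvature_sectional (x u v : V) (hu : u ∈ Submodule.span ℝ {x, I x, J x, K x})
    (hv : v ∈ Submodule.span ℝ {x, I x, J x, K x}) :
    modelCurvature I J K u v v u = 4 * (inner ℝ u u * inner ℝ v v - inner ℝ u v ^ 2) := by
  obtain ⟨h1, h2, h3⟩ := h.inner_self x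
  obtain ⟨g1, g2, g3, g4, g5, g6⟩ := h.inner_mixed x
  have h1' := real_inner_comm x (I x)
  have h2' := real_inner_comm x (J x)
  have h3' := real_inner_comm x (K x)
  have g4' := real_inner_comm (I x) (J x)
  have g5' := real_inner_comm (I x) (K x)
  have g6' := real_inner_comm (J x) (K x)
  rw [h1] at h1'; rw [h2] at h2'; rw [h3] at h3'; rw [g4] at g4'; rw [g5] at g5'; rw [g6] at g6'
  obtain ⟨iv, jv, kv⟩ := h.inner_self v
  obtain ⟨a, b, c, d, rfl⟩ := exists_of_mem_span_quadruple hu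
  obtain ⟨a', b', c', d', rfl⟩ := exists_of_mem_span_quadruple hv
  set u := a • x + b • I x + c • J x + d • K x with hu
  set v := a' • x + b' • I x + c' • J x + d' • K x with hv
  have e0 (a b c d a' b' c' d' : ℝ) : inner ℝ (a • x + b • I x + c • J x + d • K x)
      (a' • x + b' • I x + c' • J x + d' • K x) =
      (a * a' + b * b' + c * c' + d * d') * inner ℝ x x := by
    simp only [inner_add_left, inner_add_right, real_inner_smul_left, real_inner_smul_right,
      h1, h2, h3, g1, g2, g3, g4, g5, g6, h1', h2', h3', g4', g5', g6']
    ring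
  have eI : I u = (-b) • x + a • I x + (-d) • J x + c • K x := by
    simp only [hu, map_add, map_smul, h.II, h.IJ, h.IK]; module
  have eJ : J u = (-c) • x + d • I x + a • J x + (-b) • K x := by
    simp only [hu, map_add, map_smul, h.JI, h.JJ, h.JK]; module
  have eK : K u = (-d) • x + (-c) • I x + b • J x + a • K x := by
    simp only [hu, map_add, map_smul, h.KI, h.KJ, h.KK]; module
  have s1 : inner ℝ (I v) v = 0 := by rw [real_inner_comm, iv]
  have s2 : inner ℝ (J v) v = 0 := by rw [real_inner_comm, jv]
  have s3 : inner ℝ (K v) v = 0 := by rw [real_inner_comm, kv]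
  simp only [modelCurvature, s1, s2, s3, h.swapI v u, h.swapJ v u, h.swapK v u,
    real_inner_comm u v]
  rw [eI, eJ, eK, hu, hv]
  simp only [e0]
  ring

/-- The sectional curvature of a curvature tensor of quaternionic Kähler type whose sectional
curvature is `c` on the planes of every `span {x, I x, J x, K x}`. -/
theorem sectional_eq {T : V → V → V → V → ℝ} (hT : IsCurvatureLike T) (c : ℝ)
    {a b : V →ₗ[ℝ] V →ₗ[ℝ] ℝ}
    (hcomm : ∀ x y z w, T x y (I z) w + T x y z (I w) =
      a x y * inner ℝ (J z) w - b x y * inner ℝ (K z) w)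
    (hsec : ∀ x, ∀ u ∈ Submodule.span ℝ {x, I x, J x, K x},
      ∀ v ∈ Submodule.span ℝ {x, I x, J x, K x},
      T u v v u = c * (inner ℝ u u * inner ℝ v v - inner ℝ u v ^ 2)) (x y : V) :
    T x y y x = c / 4 * (inner ℝ x x * inner ℝ y y - inner ℝ x y ^ 2 +
      3 * (inner ℝ (I x) y ^ 2 + inner ℝ (J x) y ^ 2 + inner ℝ (K x) y ^ 2)) := by
  set D : V → V → V → V → ℝ := fun x y z w => T x y z w - c / 4 * modelCurvature I J K x y z w
    with hDdef
  have hD : IsCurvatureLike D := hT.sub (h.isCurvatureLike (c / 4))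
  set a' : V →ₗ[ℝ] V →ₗ[ℝ] ℝ := a + c • (innerₗ V ∘ₗ K) with ha'
  set b' : V →ₗ[ℝ] V →ₗ[ℝ] ℝ := b + c • (innerₗ V ∘ₗ J) with hb'
  have hDc : ∀ x y z w, D x y (I z) w + D x y z (I w) =
      a' x y * inner ℝ (J z) w - b' x y * inner ℝ (K z) w := by
    intro x y z w
    have h1 := hcomm x y z w
    have h2 := h.modelCurvature_comm x y z w
    simp only [hDdef, ha', hb', LinearMap.add_apply, LinearMap.smul_apply, LinearMap.comp_apply,
      innerₗ_apply_apply, smul_eq_mul]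
    linear_combination h1 - c / 4 * h2
  have hD0 : ∀ x, ∀ u ∈ Submodule.span ℝ {x, I x, J x, K x},
      ∀ v ∈ Submodule.span ℝ {x, I x, J x, K x}, ∀ z ∈ Submodule.span ℝ {x, I x, J x, K x},
      ∀ w ∈ Submodule.span ℝ {x, I x, J x, K x}, D u v z w = 0 := by
    intro x
    refine hD.eq_zero_of_sectional _ fun u hu v hv => ?_
    simp only [hDdef]
    rw [hsec x u hu v hv, h.modelCurvature_sectional x u v hu hv]
    ring
  -- Testing `hDc` against `w = J z` and `w = K z` isolates each form, by orthogonality of `J z` and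
  -- `K z`.
  have hab : ∀ x y z, a' x y * inner ℝ z z = D x y (I z) (J z) + D x y z (K z) ∧
      b' x y * inner ℝ z z = - D x y (I z) (K z) + D x y z (J z) := by
    intro x y z
    obtain ⟨-, g2, g3, -, -, g6⟩ := h.inner_mixed z
    have h1 := hDc x y z (J z)
    have h2 := hDc x y z (K z)
    rw [h.IJ, g2, real_inner_comm (J z), g6] at h1
    rw [h.IK, g3, g6, hD.neg_fourth] at h2
    constructor <;> linarith
  -- Polarizing `α x (L x) = 0` shows that each of `I`, `J`, `K` exchanges the arguments of `α`.
  -- Since `K = I J` exchanges them both once and twice, `α` is symmetric as well as skew.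
  have vanish : ∀ α : V →ₗ[ℝ] V →ₗ[ℝ] ℝ, (∀ x y, α x y = - α y x) → (∀ x, α x (I x) = 0) →
      (∀ x, α x (J x) = 0) → (∀ x, α x (K x) = 0) → ∀ x y, α x y = 0 := by
    intro α hα hI hJ hK x y
    have inv : ∀ L : V →ₗ[ℝ] V, (∀ v, L (L v) = -v) → (∀ x, α x (L x) = 0) →
        ∀ x y, α (L x) (L y) = α y x := by
      intro L hL h0 x y
      have h1 := h0 (L x)
      have := h0 (L x + y)
      simp only [map_add, LinearMap.add_apply, h0, hL, map_neg] at this h1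
      linarith
    have e1 := inv K h.KK hK x y
    rw [← h.IJ, ← h.IJ, inv I h.II hI, inv J h.JJ hJ] at e1
    linarith [hα x y]
  have mem : ∀ x : V, x ∈ Submodule.span ℝ {x, I x, J x, K x} ∧
      I x ∈ Submodule.span ℝ {x, I x, J x, K x} ∧ J x ∈ Submodule.span ℝ {x, I x, J x, K x} ∧
      K x ∈ Submodule.span ℝ {x, I x, J x, K x} := fun x => by
    refine ⟨?_, ?_, ?_, ?_⟩ <;> exact Submodule.subset_span (by simp)
  -- With `z = x` in `hab` every argument of `D` lies in `Q(x)`, where `D` vanishes.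
  have zero : ∀ x, ∀ y ∈ Submodule.span ℝ {x, I x, J x, K x}, a' x y = 0 ∧ b' x y = 0 := by
    intro x y hy
    rcases eq_or_ne x 0 with rfl | hx
    · simp
    · obtain ⟨m1, m2, m3, m4⟩ := mem x
      obtain ⟨h1, h2⟩ := hab x y x
      have hN : inner ℝ x x ≠ 0 := inner_self_ne_zero.mpr hx
      rw [hD0 x x m1 y hy _ m2 _ m3, hD0 x x m1 y hy _ m1 _ m4, add_zero] at h1
      rw [hD0 x x m1 y hy _ m2 _ m4, hD0 x x m1 y hy _ m1 _ m3, neg_zero, add_zero] at h2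
      exact ⟨(mul_eq_zero.mp h1).resolve_right hN, (mul_eq_zero.mp h2).resolve_right hN⟩
  have skew : ∀ x y, a' x y = - a' y x ∧ b' x y = - b' y x := by
    intro x y
    rcases eq_or_ne x 0 with rfl | hx
    · simp
    · obtain ⟨h1, h2⟩ := hab x y x
      obtain ⟨h3, h4⟩ := hab y x x
      have hN : inner ℝ x x ≠ 0 := inner_self_ne_zero.mpr hx
      rw [hD.swap y x, hD.swap y x] at h3 h4
      constructor <;> refine mul_right_cancel₀ hN ?_ <;> linarith
  have ha0 := vanish a' (fun x y => (skew x y).1) (fun x => (zero x _ (mem x).2.1).1)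
    (fun x => (zero x _ (mem x).2.2.1).1) (fun x => (zero x _ (mem x).2.2.2).1)
  have hb0 := vanish b' (fun x y => (skew x y).2) (fun x => (zero x _ (mem x).2.1).2)
    (fun x => (zero x _ (mem x).2.2.1).2) (fun x => (zero x _ (mem x).2.2.2).2)
  -- With `a' = b' = 0`, `D` commutes with `I`; its holomorphic curvature vanishes because `x` and
  -- `I x` lie in `Q(x)`.
  have hfin := hD.sectional_eq_zero_of_complex I h.II (fun x y z w => by
    have := hDc x y z (I w)
    rw [ha0, hb0, h.II, hD.neg_fourth] at this
    linarith) (fun x => hD0 x x (mem x).1 _ (mem x).2.1 _ (mem x).2.1 x (mem x).1) x y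
  obtain ⟨iv, jv, kv⟩ := h.inner_self y
  have s1 : inner ℝ (I y) y = 0 := by rw [real_inner_comm, iv]
  have s2 : inner ℝ (J y) y = 0 := by rw [real_inner_comm, jv]
  have s3 : inner ℝ (K y) y = 0 := by rw [real_inner_comm, kv]
  simp only [hDdef, modelCurvature, s1, s2, s3, h.swapI y x, h.swapJ y x, h.swapK y x,
    real_inner_comm x y] at hfin
  linear_combination hfin

end IsQuaternionTriple

end QuaternionicAlgebra

/-! ### From tensors on the manifold to smooth coordinate expressions. -/

section ChartMetric

variable {d : ℕ} {N : Type*} [TopologicalSpace N] [ChartedSpace (𝔼 d) N]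

/-- Smoothness of sections is defined through the bundle trivialization; this carries it over to
`coordMetric` and `coordEnd`. -/
theorem coordFrame_eq_symmL [IsManifold 𝓘(ℝ, 𝔼 d) 1 N] (p : N) {x : 𝔼 d}
    (hx : x ∈ (extChartAt 𝓘(ℝ, 𝔼 d) p).target) :
    coordFrame p x = (trivializationAt (𝔼 d) (TangentSpace 𝓘(ℝ, 𝔼 d)) p).symmL ℝ
      ((extChartAt 𝓘(ℝ, 𝔼 d) p).symm x) := by
  have h1 : (extChartAt 𝓘(ℝ, 𝔼 d) p).symm x ∈ (chartAt (𝔼 d) p).source := by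
    rw [← extChartAt_source (I := 𝓘(ℝ, 𝔼 d))]
    exact (extChartAt 𝓘(ℝ, 𝔼 d) p).map_target hx
  rw [TangentBundle.symmL_trivializationAt h1, (extChartAt 𝓘(ℝ, 𝔼 d) p).right_inv hx]
  rw [ModelWithCorners.range_eq_univ, mfderivWithin_univ]
  rfl

theorem coordFrame_self [IsManifold 𝓘(ℝ, 𝔼 d) 1 N] (p : N) :
    (coordFrame p (extChartAt 𝓘(ℝ, 𝔼 d) p p) : 𝔼 d →L[ℝ] 𝔼 d) = ContinuousLinearMap.id ℝ (𝔼 d) := by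
  have := mfderivWithin_range_extChartAt_symm (I := 𝓘(ℝ, 𝔼 d)) (x := p)
  rw [ModelWithCorners.range_eq_univ, mfderivWithin_univ] at this
  exact this

theorem coordEnd_self [IsManifold 𝓘(ℝ, 𝔼 d) 1 N]
    (A : ∀ y : N, TangentSpace 𝓘(ℝ, 𝔼 d) y →L[ℝ] TangentSpace 𝓘(ℝ, 𝔼 d) y) (p : N) :
    coordEnd A p (extChartAt 𝓘(ℝ, 𝔼 d) p p) = (A p : 𝔼 d →L[ℝ] 𝔼 d) := by
  let A' : N → 𝔼 d →L[ℝ] 𝔼 d := fun y => A y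
  let D : N → 𝔼 d →L[ℝ] 𝔼 d := fun y => mfderiv 𝓘(ℝ, 𝔼 d) 𝓘(ℝ, 𝔼 d) (extChartAt 𝓘(ℝ, 𝔼 d) p) y
  have e : (extChartAt 𝓘(ℝ, 𝔼 d) p).symm (extChartAt 𝓘(ℝ, 𝔼 d) p p) = p := extChartAt_to_inv p
  have h1 : D p = ContinuousLinearMap.id ℝ (𝔼 d) := mfderiv_extChartAt_self
  change (D ((extChartAt 𝓘(ℝ, 𝔼 d) p).symm (extChartAt 𝓘(ℝ, 𝔼 d) p p))).comp
    ((A' ((extChartAt 𝓘(ℝ, 𝔼 d) p).symm (extChartAt 𝓘(ℝ, 𝔼 d) p p))).comp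
      (coordFrame p (extChartAt 𝓘(ℝ, 𝔼 d) p p) : 𝔼 d →L[ℝ] 𝔼 d)) = A' p
  rw [coordFrame_self, e, h1]
  rfl

theorem contDiffAt_coordEnd [IsManifold 𝓘(ℝ, 𝔼 d) ∞ N]
    {σ : ∀ y : N, Submodule ℝ (TangentSpace 𝓘(ℝ, 𝔼 d) y →L[ℝ] TangentSpace 𝓘(ℝ, 𝔼 d) y)}
    {U : Set N} {J : Fin 3 → ∀ y : N, TangentSpace 𝓘(ℝ, 𝔼 d) y →L[ℝ] TangentSpace 𝓘(ℝ, 𝔼 d) y}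
    (hJ : IsCanonicalLocalBasis σ U J) {p : N} (hp : p ∈ U) (α : Fin 3) :
    ContDiffAt ℝ ∞ (coordEnd (J α) p) (extChartAt 𝓘(ℝ, 𝔼 d) p p) := by
  have h1 := (hJ.smooth α).contMDiffAt (hJ.isOpen.mem_nhds hp)
  have h2 := ((contMDiffAt_hom_bundle _).mp h1).2
  rw [← contMDiffAt_iff_contDiffAt]
  have h3 : ContMDiffAt 𝓘(ℝ, 𝔼 d) 𝓘(ℝ, 𝔼 d) ∞ (extChartAt 𝓘(ℝ, 𝔼 d) p).symm
      (extChartAt 𝓘(ℝ, 𝔼 d) p p) :=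
    (contMDiffOn_extChartAt_symm p).contMDiffAt (extChartAt_target_mem_nhds p)
  have h4 := ContMDiffAt.comp_of_eq h2 h3 (extChartAt_to_inv p)
  refine h4.congr_of_eventuallyEq ?_
  filter_upwards [extChartAt_target_mem_nhds (I := 𝓘(ℝ, 𝔼 d)) p] with x hx
  have h5 : (extChartAt 𝓘(ℝ, 𝔼 d) p).symm x ∈ (chartAt (𝔼 d) p).source := by
    rw [← extChartAt_source (I := 𝓘(ℝ, 𝔼 d))]
    exact (extChartAt 𝓘(ℝ, 𝔼 d) p).map_target hx
  have : IsManifold 𝓘(ℝ, 𝔼 d) 1 N := IsManifold.of_le (n := ∞) (by simp)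
  simp only [coordEnd, Function.comp, ContinuousLinearMap.inCoordinates]
  rw [coordFrame_eq_symmL p hx, TangentBundle.continuousLinearMapAt_trivializationAt h5]
  rfl

variable [RiemannianBundle (fun y : N => TangentSpace 𝓘(ℝ, 𝔼 d) y)]

/-- The Riemannian metric as a bilinear form on the model space. -/
def modelInner (y : N) : 𝔼 d →L[ℝ] 𝔼 d →L[ℝ] ℝ := innerSL ℝ (E := TangentSpace 𝓘(ℝ, 𝔼 d) y)

theorem modelInner_apply (y : N) (u v : TangentSpace 𝓘(ℝ, 𝔼 d) y) :
    modelInner y u v = inner ℝ u v := rfl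

theorem coordMetric_apply (p : N) (x u v : 𝔼 d) : coordMetric p x u v =
    modelInner ((extChartAt 𝓘(ℝ, 𝔼 d) p).symm x) (coordFrame p x u) (coordFrame p x v) := rfl

theorem coordMetric_self [IsManifold 𝓘(ℝ, 𝔼 d) 1 N] (p : N) :
    coordMetric p (extChartAt 𝓘(ℝ, 𝔼 d) p p) = modelInner p := by
  ext1 u
  ext1 v
  rw [coordMetric_apply, extChartAt_to_inv]
  have h := fun w : 𝔼 d => DFunLike.congr_fun (coordFrame_self p) w
  exact congrArg₂ (fun a b : 𝔼 d => modelInner p a b) (h u) (h v)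

theorem isMetricAt_coordMetric [IsManifold 𝓘(ℝ, 𝔼 d) ∞ N]
    [IsContMDiffRiemannianBundle 𝓘(ℝ, 𝔼 d) ∞ (𝔼 d) (fun y : N => TangentSpace 𝓘(ℝ, 𝔼 d) y)]
    (p : N) : IsMetricAt (coordMetric p) (extChartAt 𝓘(ℝ, 𝔼 d) p p) := by
  have : IsManifold 𝓘(ℝ, 𝔼 d) 1 N := IsManifold.of_le (n := ∞) (by simp)
  refine ⟨?_, ?_, ?_⟩
  · have key : ContDiffOn ℝ ∞ (coordMetric p) (extChartAt 𝓘(ℝ, 𝔼 d) p).target := by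
      rw [contDiffOn_clm_apply]
      intro u
      rw [contDiffOn_clm_apply]
      intro v
      set e := trivializationAt (𝔼 d) (TangentSpace 𝓘(ℝ, 𝔼 d) (M := N)) p
      -- Coordinate vector fields are smooth sections, so their inner products, the metric
      -- coefficients, are smooth.
      have hs : ∀ u : 𝔼 d, ContMDiffOn 𝓘(ℝ, 𝔼 d) (𝓘(ℝ, 𝔼 d).prod 𝓘(ℝ, 𝔼 d)) ∞
          (fun y => (TotalSpace.mk' (𝔼 d) y (e.symmL ℝ y u) : TangentBundle 𝓘(ℝ, 𝔼 d) N))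
          e.baseSet := by
        intro u
        have h1 : ContMDiffOn 𝓘(ℝ, 𝔼 d) (𝓘(ℝ, 𝔼 d).prod 𝓘(ℝ, 𝔼 d)) ∞
            (fun y : N => (y, u)) e.baseSet := contMDiffOn_id.prodMk contMDiffOn_const
        refine ((Trivialization.contMDiffOn_symm e).comp h1 fun y hy => ?_).congr fun y hy => ?_
        · exact e.mem_target.mpr hy
        · rw [e.symmL_apply hy]
          exact e.mk_symm hy u
      have h1 := (hs u).inner_bundle (hs v)
      rw [← contMDiffOn_iff_contDiffOn]
      have h2 := h1.comp (contMDiffOn_extChartAt_symm p) (fun x hx => by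
        have := (extChartAt 𝓘(ℝ, 𝔼 d) p).map_target hx
        rw [extChartAt_source] at this
        exact this)
      refine h2.congr fun x hx => ?_
      rw [coordMetric_apply, coordFrame_eq_symmL p hx]
      rfl
    exact key.contDiffAt (extChartAt_target_mem_nhds p) |>.of_le (ENat.LEInfty.out)
  · exact Filter.Eventually.of_forall fun x u v =>
      real_inner_comm (F := TangentSpace 𝓘(ℝ, 𝔼 d) ((extChartAt 𝓘(ℝ, 𝔼 d) p).symm x)) _ _
  -- Nondegeneracy: positive definiteness gives injectivity, and equal dimensions give
  -- invertibility.
  · have hinj : Function.Injective (coordMetric p (extChartAt 𝓘(ℝ, 𝔼 d) p p)) := by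
      rw [injective_iff_map_eq_zero]
      intro u hu
      rw [coordMetric_self] at hu
      exact (inner_self_eq_zero (𝕜 := ℝ) (E := TangentSpace 𝓘(ℝ, 𝔼 d) p)).mp
        (DFunLike.congr_fun hu u)
    have hfin : Module.finrank ℝ (𝔼 d) = Module.finrank ℝ (𝔼 d →L[ℝ] ℝ) := by
      rw [← (LinearMap.toContinuousLinearMap (𝕜 := ℝ) (E := 𝔼 d) (F' := ℝ)).finrank_eq]
      exact (Subspace.dual_finrank_eq).symm
    let e := (LinearEquiv.ofInjectiveOfFinrankEq
      (coordMetric p (extChartAt 𝓘(ℝ, 𝔼 d) p p)).toLinearMap hinj hfin).toContinuousLinearEquiv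
    exact ⟨e, by ext; rfl⟩

end ChartMetric

/-! ### The immersion in charts. -/

section ImmersionCoordinates

variable {n d : ℕ} {M N : Type*}
  [TopologicalSpace M] [ChartedSpace (𝔼 n) M]
  [TopologicalSpace N] [ChartedSpace (𝔼 d) N]

theorem contDiffAt_writtenInExtChartAt {f : M → N} (hf : ContMDiff 𝓘(ℝ, 𝔼 n) 𝓘(ℝ, 𝔼 d) ∞ f)
    (p : M) : ContDiffAt ℝ ∞ (writtenInExtChartAt 𝓘(ℝ, 𝔼 n) 𝓘(ℝ, 𝔼 d) p f)
      (extChartAt 𝓘(ℝ, 𝔼 n) p p) := by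
  have := (contMDiffAt_iff.mp (hf p)).2
  rw [ModelWithCorners.range_eq_univ, contDiffWithinAt_univ] at this
  exact this

theorem writtenInExtChartAt_self (f : M → N) (p : M) :
    writtenInExtChartAt 𝓘(ℝ, 𝔼 n) 𝓘(ℝ, 𝔼 d) p f (extChartAt 𝓘(ℝ, 𝔼 n) p p) =
      extChartAt 𝓘(ℝ, 𝔼 d) (f p) (f p) := by
  simp [writtenInExtChartAt]

theorem fderiv_writtenInExtChartAt {f : M → N} (hf : ContMDiff 𝓘(ℝ, 𝔼 n) 𝓘(ℝ, 𝔼 d) ∞ f) (p : M) :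
    fderiv ℝ (writtenInExtChartAt 𝓘(ℝ, 𝔼 n) 𝓘(ℝ, 𝔼 d) p f) (extChartAt 𝓘(ℝ, 𝔼 n) p p) =
      (mfderiv 𝓘(ℝ, 𝔼 n) 𝓘(ℝ, 𝔼 d) f p : 𝔼 n →L[ℝ] 𝔼 d) := by
  have h1 : MDifferentiableAt 𝓘(ℝ, 𝔼 n) 𝓘(ℝ, 𝔼 d) f p := (hf p).mdifferentiableAt (by simp)
  rw [h1.mfderiv, ModelWithCorners.range_eq_univ, fderivWithin_univ]

theorem mdifferentiableAt_extChartAt_symm [IsManifold 𝓘(ℝ, 𝔼 d) 1 N] (q : N) {z : 𝔼 d}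
    (hz : z ∈ (extChartAt 𝓘(ℝ, 𝔼 d) q).target) :
    MDifferentiableAt 𝓘(ℝ, 𝔼 d) 𝓘(ℝ, 𝔼 d) (extChartAt 𝓘(ℝ, 𝔼 d) q).symm z := by
  have := mdifferentiableWithinAt_extChartAt_symm (I := 𝓘(ℝ, 𝔼 d)) hz
  rwa [ModelWithCorners.range_eq_univ, mdifferentiableWithinAt_univ] at this

variable [RiemannianBundle (fun y : N => TangentSpace 𝓘(ℝ, 𝔼 d) y)]
  [RiemannianBundle (fun y : M => TangentSpace 𝓘(ℝ, 𝔼 n) y)]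

theorem coordMetric_eq_of_isIsometricImmersion [IsManifold 𝓘(ℝ, 𝔼 n) 1 M]
    [IsManifold 𝓘(ℝ, 𝔼 d) 1 N] {f : M → N} (hf : IsIsometricImmersion (n := n) (d := d) f)
    (p : M) : ∀ᶠ x in 𝓝 (extChartAt 𝓘(ℝ, 𝔼 n) p p), ∀ u v : 𝔼 n,
      coordMetric p x u v = coordMetric (f p) (writtenInExtChartAt 𝓘(ℝ, 𝔼 n) 𝓘(ℝ, 𝔼 d) p f x)
        (fderiv ℝ (writtenInExtChartAt 𝓘(ℝ, 𝔼 n) 𝓘(ℝ, 𝔼 d) p f) x u)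
        (fderiv ℝ (writtenInExtChartAt 𝓘(ℝ, 𝔼 n) 𝓘(ℝ, 𝔼 d) p f) x v) := by
  set F := writtenInExtChartAt 𝓘(ℝ, 𝔼 n) 𝓘(ℝ, 𝔼 d) p f with hF
  have hFc := contDiffAt_writtenInExtChartAt hf.smooth p
  have hs : ∀ᶠ x in 𝓝 (extChartAt 𝓘(ℝ, 𝔼 n) p p),
      f ((extChartAt 𝓘(ℝ, 𝔼 n) p).symm x) ∈ (extChartAt 𝓘(ℝ, 𝔼 d) (f p)).source := by
    have h1 : ContinuousAt (fun x => f ((extChartAt 𝓘(ℝ, 𝔼 n) p).symm x))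
        (extChartAt 𝓘(ℝ, 𝔼 n) p p) :=
      ContinuousAt.comp (g := f) hf.smooth.continuous.continuousAt (continuousAt_extChartAt_symm p)
    refine h1.eventually ?_
    beta_reduce
    rw [extChartAt_to_inv]
    exact extChartAt_source_mem_nhds (f p)
  have hd : ∀ᶠ x in 𝓝 (extChartAt 𝓘(ℝ, 𝔼 n) p p), DifferentiableAt ℝ F x := by
    have h1 : ContDiffAt ℝ 1 F (extChartAt 𝓘(ℝ, 𝔼 n) p p) := hFc.of_le ENat.LEInfty.out
    filter_upwards [h1.eventually (by simp)] with x hx using hx.differentiableAt (by simp)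
  have ht := extChartAt_target_mem_nhds (I := 𝓘(ℝ, 𝔼 n)) p
  filter_upwards [hs.eventually_nhds, hd, eventually_mem_nhds_iff.mpr ht] with x hx hdx htx u v
  set y := (extChartAt 𝓘(ℝ, 𝔼 n) p).symm x with hy
  have hxs := hx.self_of_nhds
  have htx' := mem_of_mem_nhds htx
  have hFt : F x ∈ (extChartAt 𝓘(ℝ, 𝔼 d) (f p)).target :=
    (extChartAt 𝓘(ℝ, 𝔼 d) (f p)).map_source hxs
  have hFx : (extChartAt 𝓘(ℝ, 𝔼 d) (f p)).symm (F x) = f y :=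
    (extChartAt 𝓘(ℝ, 𝔼 d) (f p)).left_inv hxs
  have e1 : (extChartAt 𝓘(ℝ, 𝔼 d) (f p)).symm ∘ F =ᶠ[𝓝 x] f ∘ (extChartAt 𝓘(ℝ, 𝔼 n) p).symm := by
    filter_upwards [hx] with z hz
    exact (extChartAt 𝓘(ℝ, 𝔼 d) (f p)).left_inv hz
  -- The chain rule applied to both sides of `e1`, that is, of `ψ⁻¹ ∘ F = f ∘ φ⁻¹` near `x`.
  have key : ∀ w : 𝔼 n, (coordFrame (f p) (F x) (fderiv ℝ F x w) : 𝔼 d) =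
      mfderiv 𝓘(ℝ, 𝔼 n) 𝓘(ℝ, 𝔼 d) f y (coordFrame p x w) := by
    intro w
    have h1 := mfderiv_comp (I := 𝓘(ℝ, 𝔼 n)) (I' := 𝓘(ℝ, 𝔼 d)) (I'' := 𝓘(ℝ, 𝔼 d)) x
      (mdifferentiableAt_extChartAt_symm (f p) hFt) hdx.mdifferentiableAt
    have h2 := mfderiv_comp (I := 𝓘(ℝ, 𝔼 n)) (I' := 𝓘(ℝ, 𝔼 n)) (I'' := 𝓘(ℝ, 𝔼 d)) x
      ((hf.smooth y).mdifferentiableAt (by simp)) (mdifferentiableAt_extChartAt_symm p htx')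
    have h3 := e1.mfderiv_eq (I := 𝓘(ℝ, 𝔼 n)) (I' := 𝓘(ℝ, 𝔼 d))
    refine Eq.trans (?_ : _ = mfderiv 𝓘(ℝ, 𝔼 n) 𝓘(ℝ, 𝔼 d)
      ((extChartAt 𝓘(ℝ, 𝔼 d) (f p)).symm ∘ F) x w) ((DFunLike.congr_fun h3 w).trans
        (DFunLike.congr_fun h2 w))
    refine Eq.trans ?_ (DFunLike.congr_fun h1 w).symm
    rw [mfderiv_eq_fderiv]
    rfl
  rw [coordMetric_apply, coordMetric_apply, hFx]
  have h5 := hf.isometric y (coordFrame p x u) (coordFrame p x v)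
  rw [← modelInner_apply, ← modelInner_apply] at h5
  rw [← h5]
  exact congrArg₂ (fun a b : 𝔼 d => modelInner (f y) a b) (key u).symm (key v).symm

end ImmersionCoordinates

/-! ### Averaging partial sums over permutations. -/

section Averaging

variable {ι : Type*} [DecidableEq ι]

theorem exists_perm_apply_eq {a b a' b' : ι} (h : a ≠ b) (h' : a' ≠ b') :
    ∃ τ : Equiv.Perm ι, τ a = a' ∧ τ b = b' := by
  refine ⟨Equiv.swap (Equiv.swap a a' b) b' * Equiv.swap a a', ?_, ?_⟩
  · rw [Equiv.Perm.mul_apply, Equiv.swap_apply_left]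
    refine Equiv.swap_apply_of_ne_of_ne (fun e => h ?_) h'
    exact (Equiv.swap a a').injective ((Equiv.swap_apply_left a a').trans e)
  · rw [Equiv.Perm.mul_apply, Equiv.swap_apply_left]

/-- If all partial sums `∑_{j ≠ i} K (s i) (s j)` over `k`-element families are at least `C`, then
so is, up to normalization, the total sum. -/
theorem le_sum_of_le_partial_sum [Fintype ι] (K : ι → ι → ℝ) {k : ℕ} (hk : 2 ≤ k) (hkn : k ≤ Fintype.card ι)
    (C : ℝ) (h : ∀ s : Fin k → ι, Function.Injective s → ∀ i,
      C ≤ ∑ j ∈ Finset.univ.erase i, K (s i) (s j)) :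
    (Fintype.card ι : ℝ) * ((Fintype.card ι : ℝ) - 1) * C ≤
      ((k : ℝ) - 1) * ∑ a, ∑ b ∈ Finset.univ.erase a, K a b := by
  obtain ⟨s⟩ : Nonempty (Fin k ↪ ι) := Function.Embedding.nonempty_of_card_le (by simpa using hkn)
  set i0 : Fin k := ⟨0, by omega⟩
  set i1 : Fin k := ⟨1, by omega⟩
  have h01 : s i0 ≠ s i1 := fun e => by simpa [i0, i1] using s.injective e
  set S : ℝ := ∑ τ : Equiv.Perm ι, K (τ (s i0)) (τ (s i1)) with hS
  -- The symmetric group is transitive on ordered pairs of distinct elements, so the average of `K`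
  -- over it does not see the pair. Hence `e1` collects `k - 1` copies of `S` and `e2` collects
  -- `n(n-1)`.
  have hconst : ∀ a b : ι, a ≠ b → ∑ τ : Equiv.Perm ι, K (τ a) (τ b) = S := by
    intro a b hab
    obtain ⟨ρ, h1, h2⟩ := exists_perm_apply_eq h01 hab
    rw [hS, ← h1, ← h2]
    exact Fintype.sum_equiv (Equiv.mulRight ρ) _ _ fun τ => rfl
  have e1 : (Fintype.card (Equiv.Perm ι) : ℝ) * C ≤ ((k : ℝ) - 1) * S := by
    have := Finset.sum_le_sum fun (τ : Equiv.Perm ι) (_ : τ ∈ Finset.univ) =>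
      h (fun i => τ (s i)) (τ.injective.comp s.injective) i0
    rw [Finset.sum_comm, Finset.sum_congr rfl fun j hj => hconst _ _
      (s.injective.ne (Finset.ne_of_mem_erase hj).symm)] at this
    simpa [Finset.card_erase_of_mem, Nat.cast_sub (by omega : 1 ≤ k)] using this
  have e2 : (Fintype.card (Equiv.Perm ι) : ℝ) * ∑ a, ∑ b ∈ Finset.univ.erase a, K a b =
      (Fintype.card ι : ℝ) * ((Fintype.card ι : ℝ) - 1) * S := by
    have h1 : ∀ τ : Equiv.Perm ι, ∑ a, ∑ b ∈ Finset.univ.erase a, K a b =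
        ∑ a, ∑ b ∈ Finset.univ.erase a, K (τ a) (τ b) := by
      intro τ
      refine (Fintype.sum_equiv τ _ _ fun a => ?_).symm
      refine Finset.sum_equiv τ (fun b => ?_) fun b _ => rfl
      simp
    have h2 : (Fintype.card (Equiv.Perm ι) : ℝ) * ∑ a, ∑ b ∈ Finset.univ.erase a, K a b =
        ∑ τ : Equiv.Perm ι, ∑ a, ∑ b ∈ Finset.univ.erase a, K (τ a) (τ b) := by
      rw [← Finset.sum_congr rfl fun τ _ => h1 τ]
      simp only [Finset.sum_const, Finset.card_univ, nsmul_eq_mul]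
    rw [h2, Finset.sum_comm, Finset.sum_congr rfl fun a _ => Finset.sum_comm,
      Finset.sum_congr rfl fun a _ => Finset.sum_congr rfl fun b hb => hconst a b
      (Finset.ne_of_mem_erase hb).symm]
    simp [Finset.card_erase_of_mem, Nat.cast_sub (by omega : 1 ≤ Fintype.card ι), mul_assoc]
  have hpos : (0 : ℝ) < Fintype.card (Equiv.Perm ι) := by exact_mod_cast Fintype.card_pos
  have hn : (1 : ℝ) ≤ Fintype.card ι := by exact_mod_cast (by omega : 1 ≤ Fintype.card ι)
  refine le_of_mul_le_mul_left ?_ hpos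
  calc (Fintype.card (Equiv.Perm ι) : ℝ) *
        ((Fintype.card ι : ℝ) * ((Fintype.card ι : ℝ) - 1) * C)
      = ((Fintype.card ι : ℝ) * ((Fintype.card ι : ℝ) - 1)) *
        ((Fintype.card (Equiv.Perm ι) : ℝ) * C) := by ring
    _ ≤ ((Fintype.card ι : ℝ) * ((Fintype.card ι : ℝ) - 1)) * (((k : ℝ) - 1) * S) :=
        mul_le_mul_of_nonneg_left e1 (mul_nonneg (by linarith) (by linarith))
    _ = ((k : ℝ) - 1) * ((Fintype.card (Equiv.Perm ι) : ℝ) *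
        ∑ a, ∑ b ∈ Finset.univ.erase a, K a b) := by rw [e2]; ring
    _ = _ := by ring

end Averaging

/-! ### Projections, angles and a bound for curvature tensors. -/

section Projections

variable {V : Type*} [NormedAddCommGroup V] [InnerProductSpace ℝ V] {ι : Type*} [Fintype ι]

theorem starProjection_eq_of_sub_orthogonal (W : Submodule ℝ V) [W.HasOrthogonalProjection]
    {v w : V} (hw : w ∈ W) (h : ∀ z ∈ W, inner ℝ (v - w) z = 0) : W.starProjection v = w :=
  Submodule.eq_starProjection_of_mem_of_inner_eq_zero hw h

theorem inner_starProjection_self (W : Submodule ℝ V) [W.HasOrthogonalProjection] (v : V) :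
    inner ℝ v (W.starProjection v) = ‖W.starProjection v‖ ^ 2 := by
  have h := W.starProjection_inner_eq_zero v (W.starProjection v) (W.starProjection_apply_mem v)
  rw [inner_sub_left, real_inner_self_eq_norm_sq] at h
  linarith

/-- Parseval for an orthogonal family of vectors of the same length. -/
theorem sum_inner_sq_eq [DecidableEq ι] {a : ι → V} {r : ℝ}
    (ha : ∀ i j, inner ℝ (a i) (a j) = if i = j then r else 0) (W : Submodule ℝ V)
    [W.HasOrthogonalProjection] (hW : Submodule.span ℝ (Set.range a) = W) (y : V) :
    ∑ i, inner ℝ (a i) y ^ 2 = r * ‖W.starProjection y‖ ^ 2 := by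
  rcases eq_or_ne r 0 with rfl | hr
  · have : ∀ i, a i = 0 := fun i => by
      rw [← inner_self_eq_zero (𝕜 := ℝ), ha, if_pos rfl]
    simp [this]
  have hp : W.starProjection y = ∑ i, (inner ℝ (a i) y / r) • a i := by
    refine starProjection_eq_of_sub_orthogonal W ?_ ?_
    · rw [← hW]
      exact Submodule.sum_mem _ fun i _ => Submodule.smul_mem _ _ (Submodule.subset_span ⟨i, rfl⟩)
    · intro z hz
      rw [← hW] at hz
      induction hz using Submodule.span_induction with
      | mem z hz =>
        obtain ⟨j, rfl⟩ := hz
        simp only [inner_sub_left, sum_inner, real_inner_smul_left, ha]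
        simp [hr, real_inner_comm]
      | zero => simp
      | add z w _ _ hz hw => rw [inner_add_right, hz, hw, add_zero]
      | smul t z _ hz => rw [real_inner_smul_right, hz, mul_zero]
  rw [← inner_starProjection_self, hp, inner_sum, Finset.mul_sum]
  refine Finset.sum_congr rfl fun i _ => ?_
  rw [real_inner_smul_right, real_inner_comm]
  field_simp

/-- Since `⟨v, Pv⟩ = ‖Pv‖²`, the cosine is `‖Pv‖ / ‖v‖`. When `Pv = 0` the angle takes its default
value `π / 2` and both sides vanish. -/
theorem norm_starProjection_sq_of_angle (W : Submodule ℝ V) [W.HasOrthogonalProjection] (v : V)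
    {θ : ℝ} (h : InnerProductGeometry.angle v (W.starProjection v) = θ) :
    ‖W.starProjection v‖ ^ 2 = Real.cos θ ^ 2 * ‖v‖ ^ 2 := by
  rw [← h, InnerProductGeometry.cos_angle, inner_starProjection_self]
  rcases eq_or_ne (W.starProjection v) 0 with h0 | h0
  · simp [h0]
  · have hv : v ≠ 0 := by
      rintro rfl
      simp at h0
    have := norm_ne_zero_iff.mpr h0
    have := norm_ne_zero_iff.mpr hv
    field_simp

/-- The right side depends on `I, J, K` only through the span of `I x, J x, K x`, so the sum is the
same for all canonical bases of `σ`. -/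
theorem IsQuaternionTriple.sum_inner_sq_eq {I J K : V →ₗ[ℝ] V} (h : IsQuaternionTriple I J K)
    (x y : V) (W : Submodule ℝ V) [W.HasOrthogonalProjection]
    (hW : Submodule.span ℝ {I x, J x, K x} = W) :
    inner ℝ (I x) y ^ 2 + inner ℝ (J x) y ^ 2 + inner ℝ (K x) y ^ 2 =
      inner ℝ x x * ‖W.starProjection y‖ ^ 2 := by
  obtain ⟨g1, g2, g3, g4, g5, g6⟩ := h.inner_mixed x
  rw [← QuaternionicSlant.sum_inner_sq_eq (a := ![I x, J x, K x]) (r := inner ℝ x x) ?_ W ?_ y]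
  · simp [Fin.sum_univ_three]
  · have n1 : ‖I x‖ = ‖x‖ := by simpa using g1
    have n2 : ‖J x‖ = ‖x‖ := by simpa using g2
    have n3 : ‖K x‖ = ‖x‖ := by simpa using g3
    intro i j
    fin_cases i <;> fin_cases j <;>
      simp [n1, n2, n3, g4, g5, g6, real_inner_comm (I x) (J x), real_inner_comm (I x) (K x),
        real_inner_comm (J x) (K x)]
  · rw [← hW]
    congr 1
    ext z
    simp only [Matrix.range_cons, Matrix.range_empty, Set.mem_union, Set.mem_singleton_iff,
      Set.mem_insert_iff, Set.union_empty]

/-- A curvature-like tensor on a finite-dimensional space is bounded on the unit ball. -/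
theorem IsCurvatureLike.exists_bound [FiniteDimensional ℝ V] {T : V → V → V → V → ℝ}
    (hT : IsCurvatureLike T) :
    ∃ C, ∀ x y z w : V, ‖x‖ ≤ 1 → ‖y‖ ≤ 1 → ‖z‖ ≤ 1 → ‖w‖ ≤ 1 → |T x y z w| ≤ C := by
  set b := stdOrthonormalBasis ℝ V
  have step : ∀ x y z w, ‖x‖ ≤ 1 → |T x y z w| ≤ ∑ i, |T (b i) y z w| := by
    intro x y z w hx
    let L : V →ₗ[ℝ] ℝ :=
      { toFun := fun v => T v y z w
        map_add' := fun u v => hT.add_left u v y z w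
        map_smul' := fun r v => hT.smul_left r v y z w }
    have hL : T x y z w = ∑ i, inner ℝ (b i) x * T (b i) y z w := by
      change L x = ∑ i, inner ℝ (b i) x * L (b i)
      conv_lhs => rw [← b.sum_repr' x]
      simp
    rw [hL]
    refine (Finset.abs_sum_le_sum_abs _ _).trans (Finset.sum_le_sum fun i _ => ?_)
    rw [abs_mul]
    refine mul_le_of_le_one_left (abs_nonneg _) ?_
    refine (abs_real_inner_le_norm _ _).trans ?_
    rw [b.norm_eq_one, one_mul]
    exact hx
  have sw : ∀ x y z w, |T x y z w| = |T y x z w| := fun x y z w => by rw [hT.swap, abs_neg]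
  refine ⟨∑ i, ∑ j, ∑ k, ∑ l, |T (b l) (b k) (b j) (b i)|, fun x y z w hx hy hz hw => ?_⟩
  -- The symmetries of `T` bring each slot in turn to the front, where `step` expands it in the
  -- basis.
  rw [hT.pair, sw]
  refine (step _ _ _ _ hw).trans (Finset.sum_le_sum fun i _ => ?_)
  rw [sw]
  refine (step _ _ _ _ hz).trans (Finset.sum_le_sum fun j _ => ?_)
  rw [hT.pair, sw]
  refine (step _ _ _ _ hy).trans (Finset.sum_le_sum fun k _ => ?_)
  rw [sw]
  exact step _ _ _ _ hx

end Projections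

/-! ### The Riemann tensor and the lower bound for the scalar curvature. -/

section Curvature

variable {d : ℕ} {N : Type*} [TopologicalSpace N] [ChartedSpace (𝔼 d) N]
  [RiemannianBundle (fun y : N => TangentSpace 𝓘(ℝ, 𝔼 d) y)]

/-- The Riemannian curvature as a `(0, 4)`-tensor. -/
def curvatureForm (p : N) (x y z w : TangentSpace 𝓘(ℝ, 𝔼 d) p) : ℝ :=
  inner ℝ (curvature p x y z) w

theorem sectionalCurvature_eq (p : N) (u v : TangentSpace 𝓘(ℝ, 𝔼 d) p) :
    sectionalCurvature p u v =
      curvatureForm p u v v u / (inner ℝ u u * inner ℝ v v - inner ℝ u v ^ 2) := rfl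

theorem sectionalCurvature_of_orthonormal {ι : Type*} {p : N}
    {e : ι → TangentSpace 𝓘(ℝ, 𝔼 d) p} (he : Orthonormal ℝ e) {i j : ι} (hij : i ≠ j) :
    sectionalCurvature p (e i) (e j) = curvatureForm p (e i) (e j) (e j) (e i) := by
  rw [sectionalCurvature_eq, real_inner_self_eq_norm_sq, real_inner_self_eq_norm_sq, he.1, he.1,
    he.2 hij]
  simp

variable [IsManifold 𝓘(ℝ, 𝔼 d) ∞ N]

theorem curvatureForm_eq_coordMetric (p : N) (x y z w : 𝔼 d) :
    curvatureForm p x y z w = coordMetric p (extChartAt 𝓘(ℝ, 𝔼 d) p p)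
      (coordCurvature (coordMetric p) (extChartAt 𝓘(ℝ, 𝔼 d) p p) x y z) w := by
  have : IsManifold 𝓘(ℝ, 𝔼 d) 1 N := IsManifold.of_le (n := ∞) ENat.LEInfty.out
  rw [coordMetric_self]
  rfl

variable [IsContMDiffRiemannianBundle 𝓘(ℝ, 𝔼 d) ∞ (𝔼 d) (fun y : N => TangentSpace 𝓘(ℝ, 𝔼 d) y)]

theorem isCurvatureLike_coord {E : Type*} [NormedAddCommGroup E] [NormedSpace ℝ E] [CompleteSpace E]
    {B : E → E →L[ℝ] E →L[ℝ] ℝ} {x : E} (h : IsMetricAt B x) :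
    IsCurvatureLike fun u v w z => B x (coordCurvature B x u v w) z where
  add_left a b y z w := by
    simp only [h.coordCurvature_eq, map_add, map_sub, add_apply, sub_apply]
    ring
  smul_left r a y z w := by
    simp only [h.coordCurvature_eq, map_add, map_sub, map_smul, add_apply, sub_apply, smul_apply,
      smul_eq_mul]
    ring
  swap u v w z := by
    rw [IsMetricAt.coordCurvature_swap]
    simp
  skew u v w z := h.coordCurvature_skew u v w z
  cyclic u v w z := by
    rw [← add_apply, ← map_add, ← add_apply, ← map_add, h.coordCurvature_cyclic]
    simp

theorem isCurvatureLike_curvatureForm (p : N) : IsCurvatureLike (curvatureForm (d := d) p) := by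
  have h := isCurvatureLike_coord (isMetricAt_coordMetric (d := d) p)
  have e : curvatureForm (d := d) p = fun u v w z : 𝔼 d =>
      coordMetric p (extChartAt 𝓘(ℝ, 𝔼 d) p p)
      (coordCurvature (coordMetric p) (extChartAt 𝓘(ℝ, 𝔼 d) p p) u v w) z := by
    funext u v w z
    exact curvatureForm_eq_coordMetric p u v w z
  rw [e]
  exact h

/-- Needed for the real `sInf` in `chenTheta` to be a genuine lower bound. -/
theorem bddBelow_kRicciCurvatures (p : N) (k : ℕ) : BddBelow (kRicciCurvatures (d := d) p k) := by
  obtain ⟨C, hC⟩ := (isCurvatureLike_curvatureForm (d := d) p).exists_bound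
  refine ⟨∑ _j : Fin k, -|C|, ?_⟩
  rintro r ⟨e, he, i, rfl⟩
  rw [← Finset.add_sum_erase _ _ (Finset.mem_univ i)]
  have : ∑ j ∈ Finset.univ.erase i, -|C| ≤
      ∑ j ∈ Finset.univ.erase i, sectionalCurvature p (e i) (e j) := by
    refine Finset.sum_le_sum fun j hj => ?_
    rw [sectionalCurvature_of_orthonormal he (Finset.ne_of_mem_erase hj).symm]
    have := hC (e i) (e j) (e j) (e i) (he.1 i).le (he.1 j).le (he.1 j).le (he.1 i).le
    linarith [neg_abs_le (curvatureForm p (e i) (e j) (e j) (e i)), le_abs_self C]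
  linarith [abs_nonneg C]

theorem chenTheta_le (p : N) {k n : ℕ} (hk : 2 ≤ k) (hkn : k ≤ n) {ι : Type*} [Fintype ι]
    [DecidableEq ι] (hι : Fintype.card ι = n) {e : ι → TangentSpace 𝓘(ℝ, 𝔼 d) p}
    (he : Orthonormal ℝ e) :
    (n : ℝ) * ((n : ℝ) - 1) * chenTheta (d := d) k p ≤
      ∑ a, ∑ b ∈ Finset.univ.erase a, curvatureForm p (e a) (e b) (e b) (e a) := by
  have h := le_sum_of_le_partial_sum (fun a b => sectionalCurvature p (e a) (e b)) hk
    (hι ▸ hkn) (sInf (kRicciCurvatures (d := d) p k)) (fun s hs i =>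
      csInf_le (bddBelow_kRicciCurvatures p k) ⟨fun j => e (s j), he.comp s hs, i, rfl⟩)
  rw [Finset.sum_congr rfl fun a _ => Finset.sum_congr rfl fun b hb =>
    sectionalCurvature_of_orthonormal he (Finset.ne_of_mem_erase hb).symm, hι] at h
  have hk' : (0 : ℝ) < (k : ℝ) - 1 := by
    have : (2 : ℝ) ≤ k := by exact_mod_cast hk
    linarith
  rw [chenTheta]
  refine le_of_mul_le_mul_left ?_ hk'
  refine le_trans (le_of_eq ?_) h
  field_simp

end Curvature

/-! ### Curvature of a quaternionic space form. -/

section SpaceForm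

variable {d : ℕ} {N : Type*} [TopologicalSpace N] [ChartedSpace (𝔼 d) N]
  [IsManifold 𝓘(ℝ, 𝔼 d) ∞ N]
  {σ : ∀ y : N, Submodule ℝ (TangentSpace 𝓘(ℝ, 𝔼 d) y →L[ℝ] TangentSpace 𝓘(ℝ, 𝔼 d) y)}
  {U : Set N} {J : Fin 3 → ∀ y : N, TangentSpace 𝓘(ℝ, 𝔼 d) y →L[ℝ] TangentSpace 𝓘(ℝ, 𝔼 d) y}

variable [RiemannianBundle (fun y : N => TangentSpace 𝓘(ℝ, 𝔼 d) y)]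

theorem IsCanonicalLocalBasis.span_apply (hJ : IsCanonicalLocalBasis σ U J) {q : N} (hq : q ∈ U)
    (x : TangentSpace 𝓘(ℝ, 𝔼 d) q) :
    Submodule.span ℝ {J 0 q x, J 1 q x, J 2 q x} =
      (σ q).map (ContinuousLinearMap.apply ℝ (TangentSpace 𝓘(ℝ, 𝔼 d) q) x).toLinearMap := by
  rw [← hJ.span_eq q hq, Submodule.map_span, ← Set.range_comp]
  congr 1
  ext z
  simp [Fin.exists_fin_succ, eq_comm]

theorem IsCanonicalLocalBasis.isQuaternionTriple (hJ : IsCanonicalLocalBasis σ U J)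
    (hσ : IsAdaptedMetric σ) {q : N} (hq : q ∈ U) :
    IsQuaternionTriple (J 0 q).toLinearMap (J 1 q).toLinearMap (J 2 q).toLinearMap := by
  have skew : ∀ α v w, inner ℝ (J α q v) w = -inner ℝ v (J α q w) := by
    intro α v w
    rw [← hσ U J hJ q hq α v, hJ.sq q hq, inner_neg_right, neg_neg]
  exact
    { skewI := skew 0
      skewJ := skew 1
      skewK := skew 2
      II := hJ.sq q hq 0
      JJ := hJ.sq q hq 1
      KK := hJ.sq q hq 2
      IJ := hJ.mul q hq 0
      JK := hJ.mul q hq 1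
      KI := hJ.mul q hq 2
      JI := hJ.anti q hq 0
      KJ := hJ.anti q hq 1
      IK := hJ.anti q hq 2 }

variable [IsContMDiffRiemannianBundle 𝓘(ℝ, 𝔼 d) ∞ (𝔼 d)
  (fun y : N => TangentSpace 𝓘(ℝ, 𝔼 d) y)] {c : ℝ}

/-- Removes the independence hypothesis from the definition, so that the algebraic lemmas apply: for
dependent `u`, `v` both sides are zero. -/
theorem IsQuaternionicSpaceForm.curvatureForm_of_mem_quaternionicSpan
    (hN : IsQuaternionicSpaceForm σ c) {q : N} (x : TangentSpace 𝓘(ℝ, 𝔼 d) q)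
    {u v : TangentSpace 𝓘(ℝ, 𝔼 d) q} (hu : u ∈ quaternionicSpan (σ q) x)
    (hv : v ∈ quaternionicSpan (σ q) x) :
    curvatureForm q u v v u = c * (inner ℝ u u * inner ℝ v v - inner ℝ u v ^ 2) := by
  have hT := isCurvatureLike_curvatureForm (d := d) q
  have diag : ∀ (r : ℝ) (w : TangentSpace 𝓘(ℝ, 𝔼 d) q), curvatureForm q (r • w) w w (r • w) = 0 := by
    intro r w
    have h0 : curvatureForm q w w w (r • w) = 0 := by linarith [hT.swap w w w (r • w)]
    rw [hT.smul_left, h0, mul_zero]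
  by_cases hx : x = 0
  · subst hx
    have h0 : u = 0 := by
      have : quaternionicSpan (σ q) (0 : TangentSpace 𝓘(ℝ, 𝔼 d) q) ≤ ⊥ := by
        refine Submodule.span_le.mpr ?_
        rintro z (hz | ⟨A, -, rfl⟩)
        · exact hz
        · simp
      exact this hu
    have := diag 0 v
    rw [zero_smul] at this
    rw [h0, this]
    simp
  by_cases hli : LinearIndependent ℝ ![u, v]
  · have h1 := hN.sectional q x hx u hu v hv hli
    have hne : inner ℝ u u * inner ℝ v v - inner ℝ u v ^ 2 ≠ 0 := by
      intro h0
      have h2 : (inner ℝ v v) • u + (-inner ℝ u v) • v = 0 := by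
        rw [← inner_self_eq_zero (𝕜 := ℝ)]
        simp only [inner_add_left, inner_add_right, real_inner_smul_left, real_inner_smul_right,
          real_inner_comm u v]
        linear_combination inner ℝ v v * h0
      have h3 := (LinearIndependent.pair_iff.mp hli _ _ h2).1
      exact hli.ne_zero 1 (by simpa using h3)
    rw [sectionalCurvature_eq, div_eq_iff hne] at h1
    exact h1
  · rw [LinearIndependent.pair_iff] at hli
    push Not at hli
    obtain ⟨s, t, h1, h2⟩ := hli
    by_cases hs : s = 0
    · have ht := h2 hs
      rw [hs, zero_smul, zero_add] at h1
      have hv0 : v = 0 := (smul_eq_zero.mp h1).resolve_left ht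
      have := hT.smul_right 0 u 0 0 u
      rw [zero_smul, zero_mul] at this
      rw [hv0, this]
      simp
    · have hu' : u = (-t / s) • v := by
        have : s • u = (-t) • v := by rw [neg_smul]; exact eq_neg_of_add_eq_zero_left h1
        rw [div_eq_inv_mul, mul_smul, ← this, smul_smul, inv_mul_cancel₀ hs, one_smul]
      rw [hu', diag]
      simp only [real_inner_smul_left, real_inner_smul_right]
      ring

theorem IsQuaternionicSpaceForm.curvatureForm_eq (hN : IsQuaternionicSpaceForm σ c) {q : N}
    (hJ : IsCanonicalLocalBasis σ U J) (hq : q ∈ U) (x y : TangentSpace 𝓘(ℝ, 𝔼 d) q) :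
    curvatureForm q x y y x = c / 4 * (inner ℝ x x * inner ℝ y y - inner ℝ x y ^ 2 +
      3 * ∑ α, inner ℝ (J α q x) y ^ 2) := by
  have : IsManifold 𝓘(ℝ, 𝔼 d) 1 N := IsManifold.of_le (n := ∞) ENat.LEInfty.out
  obtain ⟨U', A, hqU', hU's, hA, η, hη, hpar⟩ := hN.quaternionicKaehler.parallel q
  have hm := isMetricAt_coordMetric (d := d) q
  have hnhds : extChartAt 𝓘(ℝ, 𝔼 d) q '' U' ∈ 𝓝 (extChartAt 𝓘(ℝ, 𝔼 d) q q) := by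
    have := (isOpen_extChartAt_source q).mem_nhds (mem_extChartAt_source (I := 𝓘(ℝ, 𝔼 d)) q)
    have := extChartAt_image_nhds_mem_nhds_of_boundaryless (I := 𝓘(ℝ, 𝔼 d)) (x := q)
      (hA.isOpen.mem_nhds hqU')
    exact this
  -- The Ricci identity is available only for the basis `A` supplied by parallelism; the formula
  -- passes to `J` at the end, where both sums are projections onto the image of `σ q` under
  -- evaluation at `x`.
  obtain ⟨ρ, hρ⟩ := hm.coordCurvature_comm (A := fun α => coordEnd (A α) q) (η := η)
    (fun α => (contDiffAt_coordEnd hA hqU' α).of_le ENat.LEInfty.out)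
    (fun α => ((hη α).contDiffAt hnhds).differentiableAt (by simp))
    (by filter_upwards [hnhds] with y hy α u v using hpar y hy α u v)
  simp only [coordEnd_self] at hρ
  have hAt := hA.isQuaternionTriple hN.quaternionicKaehler.adapted hqU'
  have hJt := hJ.isQuaternionTriple hN.quaternionicKaehler.adapted hq
  have hT := isCurvatureLike_curvatureForm (d := d) q
  let toBil (B : 𝔼 d →L[ℝ] 𝔼 d →L[ℝ] ℝ) :
    TangentSpace 𝓘(ℝ, 𝔼 d) q →ₗ[ℝ] TangentSpace 𝓘(ℝ, 𝔼 d) q →ₗ[ℝ] ℝ := B.toBilinForm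
  have h1 := hAt.sectional_eq hT c (a := toBil (ρ 2)) (b := toBil (ρ 1))
    (fun x y z w => by
      have h2 : curvature q x y (A 0 q z) - A 0 q (curvature q x y z) =
        (ρ 2 x y • A 1 q z - ρ 1 x y • A 2 q z : TangentSpace 𝓘(ℝ, 𝔼 d) q) := hρ x y z
      have h3 := congrArg (fun v : TangentSpace 𝓘(ℝ, 𝔼 d) q => inner ℝ v w) h2
      simp only [inner_sub_left, real_inner_smul_left] at h3
      have h4 := hAt.skewI (curvature q x y z) w
      simp only [ContinuousLinearMap.coe_coe] at h4 ⊢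
      change inner ℝ (curvature q x y (A 0 q z)) w + inner ℝ (curvature q x y z) (A 0 q w) =
        ρ 2 x y * inner ℝ (A 1 q z) w - ρ 1 x y * inner ℝ (A 2 q z) w
      linarith)
    (fun x u hu v hv => by
      have hle : Submodule.span ℝ {x, A 0 q x, A 1 q x, A 2 q x} ≤ quaternionicSpan (σ q) x := by
        refine Submodule.span_mono ?_
        have hmem : ∀ α, A α q ∈ σ q := fun α => by
          rw [← hA.span_eq q hqU']
          exact Submodule.subset_span ⟨α, rfl⟩
        rintro z (rfl | rfl | rfl | rfl)
        · exact Or.inl rfl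
        · exact Or.inr ⟨_, hmem 0, rfl⟩
        · exact Or.inr ⟨_, hmem 1, rfl⟩
        · exact Or.inr ⟨_, hmem 2, rfl⟩
      exact hN.curvatureForm_of_mem_quaternionicSpan x (hle hu) (hle hv)) x y
  have h2 := hAt.sum_inner_sq_eq x y _ (hA.span_apply hqU' x)
  have h3 := hJt.sum_inner_sq_eq x y _ (hJ.span_apply hq x)
  rw [h1, h2, ← h3, Fin.sum_univ_three]
  rfl

end SpaceForm

/-! ### The Gauss equation on the manifold. -/

section Gauss

variable {n d : ℕ} {M N : Type*}
  [TopologicalSpace M] [ChartedSpace (𝔼 n) M] [TopologicalSpace N] [ChartedSpace (𝔼 d) N]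
  [RiemannianBundle (fun y : N => TangentSpace 𝓘(ℝ, 𝔼 d) y)]

variable [RiemannianBundle (fun y : M => TangentSpace 𝓘(ℝ, 𝔼 n) y)]
  {f : M → N} (hf : IsIsometricImmersion (n := n) (d := d) f)
include hf

theorem IsIsometricImmersion.sum_inner_sq_eq {ι : Type*} [Fintype ι] [DecidableEq ι] (p : M)
    (e : OrthonormalBasis ι ℝ (TangentSpace 𝓘(ℝ, 𝔼 n) p)) (y : TangentSpace 𝓘(ℝ, 𝔼 d) (f p)) :
    ∑ i, inner ℝ (mfderiv 𝓘(ℝ, 𝔼 n) 𝓘(ℝ, 𝔼 d) f p (e i)) y ^ 2 =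
      ‖(tangentImage (n := n) f p).starProjection y‖ ^ 2 := by
  rw [← one_mul (‖_‖ ^ 2)]
  refine QuaternionicSlant.sum_inner_sq_eq (fun i j => ?_) _ ?_ y
  · rw [hf.isometric, orthonormal_iff_ite.mp e.orthonormal]
  · rw [tangentImage, LinearMap.range_eq_map, ← e.toBasis.span_eq, Submodule.map_span,
      ← Set.range_comp]
    congr 2

variable [IsManifold 𝓘(ℝ, 𝔼 d) ∞ N]
  [IsContMDiffRiemannianBundle 𝓘(ℝ, 𝔼 d) ∞ (𝔼 d) (fun y : N => TangentSpace 𝓘(ℝ, 𝔼 d) y)]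

theorem IsIsometricImmersion.secondFundamentalForm_comm (p : M)
    (u v : TangentSpace 𝓘(ℝ, 𝔼 n) p) :
    secondFundamentalForm (d := d) f p u v = secondFundamentalForm f p v u := by
  have hF := contDiffAt_writtenInExtChartAt hf.smooth p
  have h' : IsMetricAt (coordMetric (f p)) (writtenInExtChartAt 𝓘(ℝ, 𝔼 n) 𝓘(ℝ, 𝔼 d) p f
      (extChartAt 𝓘(ℝ, 𝔼 n) p p)) := by
    rw [writtenInExtChartAt_self]
    exact isMetricAt_coordMetric (f p)
  have h : ambientCovDeriv (d := d) f p u v = ambientCovDeriv f p v u :=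
    covDerivAlong_comm h' (hF.of_le ENat.LEInfty.out) u v
  rw [secondFundamentalForm, secondFundamentalForm, h]

variable [IsManifold 𝓘(ℝ, 𝔼 n) ∞ M]
  [IsContMDiffRiemannianBundle 𝓘(ℝ, 𝔼 n) ∞ (𝔼 n) (fun y : M => TangentSpace 𝓘(ℝ, 𝔼 n) y)]

/-- The Gauss equation. -/
theorem IsIsometricImmersion.gauss (p : M) (u v w z : TangentSpace 𝓘(ℝ, 𝔼 n) p) :
    curvatureForm p u v w z =
      curvatureForm (d := d) (f p) (mfderiv 𝓘(ℝ, 𝔼 n) 𝓘(ℝ, 𝔼 d) f p u)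
        (mfderiv 𝓘(ℝ, 𝔼 n) 𝓘(ℝ, 𝔼 d) f p v) (mfderiv 𝓘(ℝ, 𝔼 n) 𝓘(ℝ, 𝔼 d) f p w)
        (mfderiv 𝓘(ℝ, 𝔼 n) 𝓘(ℝ, 𝔼 d) f p z)
      + inner ℝ (secondFundamentalForm (d := d) f p v w) (secondFundamentalForm f p u z)
      - inner ℝ (secondFundamentalForm (d := d) f p u w) (secondFundamentalForm f p v z) := by
  have i1 : IsManifold 𝓘(ℝ, 𝔼 d) 1 N := IsManifold.of_le (n := ∞) ENat.LEInfty.out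
  have i2 : IsManifold 𝓘(ℝ, 𝔼 n) 1 M := IsManifold.of_le (n := ∞) ENat.LEInfty.out
  have hF : ContDiffAt ℝ 3 _ _ :=
    (contDiffAt_writtenInExtChartAt hf.smooth p).of_le ENat.LEInfty.out
  have hiso := coordMetric_eq_of_isIsometricImmersion hf p
  have h := isMetricAt_coordMetric (d := n) p
  have h' : IsMetricAt (coordMetric (f p)) (writtenInExtChartAt 𝓘(ℝ, 𝔼 n) 𝓘(ℝ, 𝔼 d) p f
      (extChartAt 𝓘(ℝ, 𝔼 n) p p)) := by
    rw [writtenInExtChartAt_self]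
    exact isMetricAt_coordMetric (f p)
  have ht := apply_covDerivAlong h h' hF hiso
  have hg := gauss_coord h h' hF hiso u v w z
  rw [writtenInExtChartAt_self, coordMetric_self] at ht hg
  simp only [coordMetric_self, fderiv_writtenInExtChartAt hf.smooth] at ht hg
  set df : TangentSpace 𝓘(ℝ, 𝔼 n) p →L[ℝ] TangentSpace 𝓘(ℝ, 𝔼 d) (f p) :=
    mfderiv 𝓘(ℝ, 𝔼 n) 𝓘(ℝ, 𝔼 d) f p with hdf
  set W : Submodule ℝ (TangentSpace 𝓘(ℝ, 𝔼 d) (f p)) := tangentImage (n := n) f p with hW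
  let A : TangentSpace 𝓘(ℝ, 𝔼 n) p → TangentSpace 𝓘(ℝ, 𝔼 n) p → TangentSpace 𝓘(ℝ, 𝔼 d) (f p) :=
    fun u v => ambientCovDeriv f p u v
  let Γ : TangentSpace 𝓘(ℝ, 𝔼 n) p → TangentSpace 𝓘(ℝ, 𝔼 n) p → TangentSpace 𝓘(ℝ, 𝔼 n) p :=
    fun u v => christoffelCLM (coordMetric p) (extChartAt 𝓘(ℝ, 𝔼 n) p p) u v
  have ht' : ∀ u v w, inner ℝ (A u v) (df w) = inner ℝ (Γ u v) w := ht
  have hg' : curvatureForm p u v w z = curvatureForm (f p) (df u) (df v) (df w) (df z)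
      + inner ℝ (A v w) (A u z) - inner ℝ (A u w) (A v z)
      - inner ℝ (Γ v w) (Γ u z) + inner ℝ (Γ u w) (Γ v z) := hg
  have hproj : ∀ u v, W.starProjection (A u v) = df (Γ u v) := by
    intro u v
    refine starProjection_eq_of_sub_orthogonal W ⟨_, rfl⟩ ?_
    rintro _ ⟨w, rfl⟩
    change inner ℝ (A u v - df (Γ u v)) (df w) = 0
    rw [inner_sub_left, ht', hdf, hf.isometric, sub_self]
  -- Subtracting the tangential parts `df (Γ a b)` and `df (Γ c e)` costs exactly the Christoffel
  -- products that `gauss_coord` leaves over.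
  have hh : ∀ a b c e, inner ℝ (secondFundamentalForm (d := d) f p a b)
      (secondFundamentalForm f p c e) = inner ℝ (A a b) (A c e) - inner ℝ (Γ a b) (Γ c e) := by
    intro a b c e
    change inner ℝ (A a b - W.starProjection (A a b)) (A c e - W.starProjection (A c e)) = _
    rw [hproj, hproj]
    simp only [inner_sub_left, inner_sub_right, ht']
    rw [real_inner_comm (A c e) (df _), ht', hdf, hf.isometric, real_inner_comm (Γ a b) (Γ c e)]
    ring
  rw [hg', hh, hh]
  ring

end Gauss

section ChenInequality

variable {V ι : Type*} [NormedAddCommGroup V] [Fintype ι]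

/-- The trace `H = ∑ h a a` of a family of vectors satisfies `‖H‖² ≤ card ι * ∑ ‖h a b‖²`. -/
theorem norm_trace_sq_le (h : ι → ι → V) :
    ‖∑ a, h a a‖ ^ 2 ≤ Fintype.card ι * ∑ a, ∑ b, ‖h a b‖ ^ 2 := by
  calc ‖∑ a, h a a‖ ^ 2 ≤ (∑ a, ‖h a a‖) ^ 2 := by gcongr; exact norm_sum_le _ _
    _ ≤ Fintype.card ι * ∑ a, ‖h a a‖ ^ 2 := by
        simpa using sq_sum_le_card_mul_sum_sq (s := Finset.univ) (f := fun a => ‖h a a‖)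
    _ ≤ Fintype.card ι * ∑ a, ∑ b, ‖h a b‖ ^ 2 := by
        gcongr with a
        exact Finset.single_le_sum (f := fun b => ‖h a b‖ ^ 2) (fun b _ => by positivity)
          (Finset.mem_univ a)

end ChenInequality

/-! ### Upper bound for the scalar curvature of a slant submanifold. -/

section SlantSubmanifold

variable {n d : ℕ} {M N : Type*}
  [TopologicalSpace M] [ChartedSpace (𝔼 n) M] [TopologicalSpace N] [ChartedSpace (𝔼 d) N]
  [RiemannianBundle (fun y : N => TangentSpace 𝓘(ℝ, 𝔼 d) y)]
  [RiemannianBundle (fun y : M => TangentSpace 𝓘(ℝ, 𝔼 n) y)]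
  [IsManifold 𝓘(ℝ, 𝔼 d) ∞ N]
  [IsContMDiffRiemannianBundle 𝓘(ℝ, 𝔼 d) ∞ (𝔼 d) (fun y : N => TangentSpace 𝓘(ℝ, 𝔼 d) y)]
  {f : M → N} (hf : IsIsometricImmersion (n := n) (d := d) f)
  {σ : ∀ y : N, Submodule ℝ (TangentSpace 𝓘(ℝ, 𝔼 d) y →L[ℝ] TangentSpace 𝓘(ℝ, 𝔼 d) y)} {c θ : ℝ}
include hf

/-- The sum of the ambient sectional curvatures of the coordinate planes of a tangent space of a
slant submanifold. -/
theorem IsIsometricImmersion.sum_ambient_curvatureForm (hN : IsQuaternionicSpaceForm σ c)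
    (hslant : IsSlant (n := n) σ f θ) {ι : Type*} [Fintype ι] [DecidableEq ι] (p : M)
    (e : OrthonormalBasis ι ℝ (TangentSpace 𝓘(ℝ, 𝔼 n) p)) :
    ∑ a, ∑ b, curvatureForm (f p) (mfderiv 𝓘(ℝ, 𝔼 n) 𝓘(ℝ, 𝔼 d) f p (e a))
        (mfderiv 𝓘(ℝ, 𝔼 n) 𝓘(ℝ, 𝔼 d) f p (e b)) (mfderiv 𝓘(ℝ, 𝔼 n) 𝓘(ℝ, 𝔼 d) f p (e b))
        (mfderiv 𝓘(ℝ, 𝔼 n) 𝓘(ℝ, 𝔼 d) f p (e a)) =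
      c / 4 * ((Fintype.card ι : ℝ) * ((Fintype.card ι : ℝ) - 1) +
        9 * Fintype.card ι * Real.cos θ ^ 2) := by
  obtain ⟨U, J, hU, hJ, hang⟩ := hslant p
  set E : ι → TangentSpace 𝓘(ℝ, 𝔼 d) (f p) := fun a => mfderiv 𝓘(ℝ, 𝔼 n) 𝓘(ℝ, 𝔼 d) f p (e a)
    with hE
  have hEo : ∀ a b, inner ℝ (E a) (E b) = if a = b then (1 : ℝ) else 0 := fun a b => by
    rw [hE, hf.isometric, orthonormal_iff_ite.mp e.orthonormal]
  have hEn : ∀ a, inner ℝ (E a) (E a) = (1 : ℝ) := fun a => by rw [hEo, if_pos rfl]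
  -- By Parseval the sum is the squared length of the tangential part of the unit vector `J_α E_a`.
  -- Three values of `α` with weight `3` give the constant `9`.
  have hP : ∀ α a, ∑ b, inner ℝ (J α (f p) (E a)) (E b) ^ 2 = Real.cos θ ^ 2 := by
    intro α a
    have hne : E a ≠ 0 := fun h0 => by simpa [h0] using hEn a
    have h1 := norm_starProjection_sq_of_angle _ _ (hang α (E a) ⟨e a, rfl⟩ hne)
    have h2 : ‖J α (f p) (E a)‖ ^ 2 = 1 := by
      rw [← real_inner_self_eq_norm_sq, hN.quaternionicKaehler.adapted U J hJ _ hU, hEn]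
    rw [h2, mul_one, ← hf.sum_inner_sq_eq p e] at h1
    rw [← h1]
    exact Finset.sum_congr rfl fun b _ => by rw [real_inner_comm]
  have hK : ∀ a b, curvatureForm (f p) (E a) (E b) (E b) (E a) =
      c / 4 * (1 - (if a = b then 1 else 0) + 3 * ∑ α, inner ℝ (J α (f p) (E a)) (E b) ^ 2) := by
    intro a b
    rw [hN.curvatureForm_eq hJ hU, hEn, hEn, hEo]
    split_ifs <;> ring
  calc ∑ a, ∑ b, curvatureForm (f p) (E a) (E b) (E b) (E a)
      = ∑ a : ι, c / 4 * ((Fintype.card ι : ℝ) - 1 + 9 * Real.cos θ ^ 2) := by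
        refine Finset.sum_congr rfl fun a _ => ?_
        rw [Finset.sum_congr rfl fun b _ => hK a b, ← Finset.mul_sum, Finset.sum_add_distrib,
          ← Finset.mul_sum, Finset.sum_comm, Finset.sum_congr rfl fun α _ => hP α a]
        simp
        left
        ring
    _ = _ := by
        simp
        ring

variable [IsManifold 𝓘(ℝ, 𝔼 n) ∞ M]
  [IsContMDiffRiemannianBundle 𝓘(ℝ, 𝔼 n) ∞ (𝔼 n) (fun y : M => TangentSpace 𝓘(ℝ, 𝔼 n) y)]

/-- The upper bound for the scalar curvature of a slant submanifold of a quaternionic space form. -/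
theorem IsIsometricImmersion.sum_curvatureForm_le (hN : IsQuaternionicSpaceForm σ c)
    (hslant : IsSlant (n := n) σ f θ) (p : M) (hn : 1 ≤ n) {ι : Type*} [Fintype ι] [DecidableEq ι]
    (hι : Fintype.card ι = n) (e : OrthonormalBasis ι ℝ (TangentSpace 𝓘(ℝ, 𝔼 n) p))  :
    ∑ a, ∑ b ∈ Finset.univ.erase a, curvatureForm p (e a) (e b) (e b) (e a) ≤
      ((n : ℝ) - 1) / n * ‖∑ a, secondFundamentalForm (d := d) f p (e a) (e a)‖ ^ 2 +
      c / 4 * ((n : ℝ) * ((n : ℝ) - 1) + 9 * n * Real.cos θ ^ 2) := by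
  have hT := isCurvatureLike_curvatureForm (d := n) p
  have hdiag : ∀ a, curvatureForm p (e a) (e a) (e a) (e a) = 0 := fun a => by
    linarith [hT.swap (e a) (e a) (e a) (e a)]
  -- The diagonal terms are zero, so the double sums run over all pairs and `∑ ⟨h b b, h a a⟩`
  -- becomes the square of the trace.
  have h1 : ∀ a, ∑ b ∈ Finset.univ.erase a, curvatureForm p (e a) (e b) (e b) (e a) =
      ∑ b, curvatureForm p (e a) (e b) (e b) (e a) := fun a => by
    rw [← Finset.add_sum_erase _ _ (Finset.mem_univ a), hdiag, zero_add]
  set h : ι → ι → TangentSpace 𝓘(ℝ, 𝔼 d) (f p) := fun a b =>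
    secondFundamentalForm (d := d) f p (e a) (e b) with hh
  have h2 : ∀ a b, curvatureForm p (e a) (e b) (e b) (e a) =
      curvatureForm (f p) (mfderiv 𝓘(ℝ, 𝔼 n) 𝓘(ℝ, 𝔼 d) f p (e a))
        (mfderiv 𝓘(ℝ, 𝔼 n) 𝓘(ℝ, 𝔼 d) f p (e b)) (mfderiv 𝓘(ℝ, 𝔼 n) 𝓘(ℝ, 𝔼 d) f p (e b))
        (mfderiv 𝓘(ℝ, 𝔼 n) 𝓘(ℝ, 𝔼 d) f p (e a)) + inner ℝ (h b b) (h a a) - ‖h a b‖ ^ 2 := by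
    intro a b
    rw [hf.gauss, hf.secondFundamentalForm_comm p (e b) (e a), real_inner_self_eq_norm_sq]
  have h3 : ∑ a, ∑ b, inner ℝ (h b b) (h a a) = ‖∑ a, h a a‖ ^ 2 := by
    rw [← real_inner_self_eq_norm_sq, inner_sum]
    exact Finset.sum_congr rfl fun a _ => (sum_inner _ _ _).symm
  have h4 := norm_trace_sq_le h
  rw [hι] at h4
  have hn' : (0 : ℝ) < n := by exact_mod_cast hn
  have h5 : ‖∑ a, h a a‖ ^ 2 / n ≤ ∑ a, ∑ b, ‖h a b‖ ^ 2 := by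
    rw [div_le_iff₀ hn', mul_comm]
    exact h4
  have h6 : ((n : ℝ) - 1) / n * ‖∑ a, h a a‖ ^ 2 = ‖∑ a, h a a‖ ^ 2 - ‖∑ a, h a a‖ ^ 2 / n := by
    field_simp
  rw [Finset.sum_congr rfl fun a _ => h1 a,
    Finset.sum_congr rfl fun a _ => Finset.sum_congr rfl fun b _ => h2 a b]
  simp only [Finset.sum_add_distrib, Finset.sum_sub_distrib]
  rw [hf.sum_ambient_curvatureForm hN hslant p e, h3, hι, h6]
  linarith

end SlantSubmanifold

end QuaternionicSlant

end

theorem theorem1p1 {m n : ℕ} {M N : Type*}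
    [TopologicalSpace N] [ChartedSpace (EuclideanSpace ℝ (Fin (4 * m))) N]
    [IsManifold 𝓘(ℝ, EuclideanSpace ℝ (Fin (4 * m))) ∞ N]
    [RiemannianBundle (fun y : N => TangentSpace 𝓘(ℝ, EuclideanSpace ℝ (Fin (4 * m))) y)]
    [IsContMDiffRiemannianBundle 𝓘(ℝ, EuclideanSpace ℝ (Fin (4 * m))) ∞
      (EuclideanSpace ℝ (Fin (4 * m)))
      (fun y : N => TangentSpace 𝓘(ℝ, EuclideanSpace ℝ (Fin (4 * m))) y)]
    [TopologicalSpace M] [ChartedSpace (EuclideanSpace ℝ (Fin n)) M]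
    [IsManifold 𝓘(ℝ, EuclideanSpace ℝ (Fin n)) ∞ M]
    [RiemannianBundle (fun y : M => TangentSpace 𝓘(ℝ, EuclideanSpace ℝ (Fin n)) y)]
    [IsContMDiffRiemannianBundle 𝓘(ℝ, EuclideanSpace ℝ (Fin n)) ∞
      (EuclideanSpace ℝ (Fin n))
      (fun y : M => TangentSpace 𝓘(ℝ, EuclideanSpace ℝ (Fin n)) y)]
    (σ : ∀ y : N, Submodule ℝ
      (TangentSpace 𝓘(ℝ, EuclideanSpace ℝ (Fin (4 * m))) y →L[ℝ]
        TangentSpace 𝓘(ℝ, EuclideanSpace ℝ (Fin (4 * m))) y))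
    (c θ : ℝ) (f : M → N)
    (hN : QuaternionicSlant.IsQuaternionicSpaceForm σ c)
    (hf : QuaternionicSlant.IsIsometricImmersion (n := n) (d := 4 * m) f)
    (hslant : QuaternionicSlant.IsProperSlant (n := n) σ f θ)
    (p : M) (k : ℕ) (hk : 2 ≤ k) (hkn : k ≤ n) :
    QuaternionicSlant.chenTheta (d := n) k p
        - c / 4 * (1 + 9 / ((n : ℝ) - 1) * Real.cos θ ^ 2)
      ≤ ‖QuaternionicSlant.meanCurvature (n := n) (d := 4 * m) f p‖ ^ 2 := by
  set ι := Fin (Module.finrank ℝ (TangentSpace 𝓘(ℝ, EuclideanSpace ℝ (Fin n)) p))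
  set e := stdOrthonormalBasis ℝ (TangentSpace 𝓘(ℝ, EuclideanSpace ℝ (Fin n)) p) with he
  have hι : Fintype.card ι = n := by
    rw [Fintype.card_fin]
    exact finrank_euclideanSpace_fin
  have hn : (2 : ℝ) ≤ n := by exact_mod_cast hk.trans hkn
  have h1 := QuaternionicSlant.chenTheta_le p hk hkn hι e.orthonormal
  have h2 := hf.sum_curvatureForm_le hN hslant.slant p (by omega) hι e
  -- `e` is the very basis used in `meanCurvature`, so no independence of the basis is needed.
  have h3 : ∑ a, QuaternionicSlant.secondFundamentalForm (d := 4 * m) f p (e a) (e a) =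
      (n : ℝ) • QuaternionicSlant.meanCurvature (n := n) (d := 4 * m) f p := by
    rw [QuaternionicSlant.meanCurvature, smul_smul, mul_one_div_cancel (by positivity), one_smul]
  rw [h3, norm_smul, mul_pow, Real.norm_eq_abs, sq_abs] at h2
  have hpos : (0 : ℝ) < n * ((n : ℝ) - 1) := mul_pos (by linarith) (by linarith)
  have hn1 : (n : ℝ) - 1 ≠ 0 := by linarith
  -- After multiplication by `n(n-1)`, the claim is `h1` followed by `h2` with the ambient sum moved
  -- to the left; `n(n-1)‖H‖²` arises as `(n-1)/n · n²‖H‖²`.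
  refine le_of_mul_le_mul_left ?_ hpos
  refine le_trans (le_of_eq ?_) (le_trans (sub_le_sub_right (h1.trans h2)
    (c / 4 * ((n : ℝ) * ((n : ℝ) - 1) + 9 * n * Real.cos θ ^ 2))) (le_of_eq ?_))
  · field_simp
  · field_simp
    ring
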